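/- **Theorem (Stability of Scheme-I).** *Setting.* Let $d\in\{2,3\}$, let $\Omega\subset\mathbb R^d$ be a bounded domain and let $\Omega_h$ be a conforming triangulation of $\Omega$ into finitely many $d$-simplices $K$ with $\overline\Omega=\bigcup K$ and $\operatorname{int}K\subset\Omega$; let $h=\max_K\operatorname{diam}K$. Let $\mathcal E$ be the set of $(d-1)$-faces, $\mathcal E^E$ those contained in $\partial\Omega$, $\mathcal E^I=\mathcal E\setminus\mathcal E^E$, and fix a unit normal $\mathbf n_\sigma$ of each face $\sigma$, pointing outwards on $\mathcal E^E$. For $\sigma\in\mathcal E^I$, $f^{\rm in}$ and $f^{\rm out}$ are the traces of $f$ from the element out of which, respectively into which, $\mathbf n_\sigma$ points; $[\![f]\!]=f^{\rm out}-f^{\rm in}$, $\{\!\{f\}\!\}=\frac12(f^{\rm out}+f^{\rm in})$. Operators $\nabla_h,\operatorname{div}_h,\operatorname{Curl}_h$ act elementwise; for $d=2$ cross products and curls are those of the fields extended by a zero third component and independent of $x_3$. For a field $\mathbf v$, $\widehat{\mathbf v}$ is the piecewise constant function with value $\frac1{|K|}\int_K\mathbf v$ on $K$. *Spaces.* $Q_h$: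 piecewise constant scalar functions. $V_h$: piecewise affine $\mathbb R^d$-valued fields with $\int_\sigma[\![\mathbf v]\!]=0$ for $\sigma\in\mathcal E^I$; $V_{0,h}$: those with moreover $\int_\sigma\mathbf v=0$ for $\sigma\in\mathcal E^E$. $N_h$: fields with $\mathbf v,\operatorname{Curl}\mathbf v\in L^2(\Omega)$ of the form $\mathbf a_K+S_K x$ on each $K$ with $\mathbf a_K\in\mathbb R^d$ and $S_K$ a skew-symmetric $d\times d$ matrix, and $\int_\sigma[\![\mathbf v\times\mathbf n]\!]=0$ for $\sigma\in\mathcal E^I$ (lowest order Nédélec elements); $N_{0,h}$: those with moreover $\int_\sigma\mathbf v\times\mathbf n=0$ for $\sigma\in\mathcal E^E$. *Scheme.* Let $\mu>0$, $\lambda\ge0$, $\nu=\frac{d-2}{d}\mu+\lambda$, $\alpha>0$, $a>0$, $\gamma>1$, $p(\varrho)=a\varrho^\gamma$, $\mathcal H(\varrho)=\frac{a}{\gamma-1}\varrho^\gamma$, $\varepsilon>0$, $\Delta t>0$, $N\in\mathbb N$. For a sequence $(v^k)$ write $v^\triangleleft=v^{k-1}$ and $D_tv=(v^k-v^{k-1})/\Delta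 t$ at step $k$. Let $u_\sigma=\frac1{|\sigma|}\int_\sigma\mathbf u_h\cdot\mathbf n_\sigma$, $[s]^\pm=\frac{s\pm|s|}2$, $r^{\rm up}=r^{\rm in}$ if $u_\sigma\ge0$ and $r^{\rm up}=r^{\rm out}$ otherwise, and $F_h^\varepsilon(r,\mathbf u_h)=r^{\rm in}[u_\sigma]^++r^{\rm out}[u_\sigma]^--h^\varepsilon[\![r]\!]$. Let $\varrho_0\in L^1(\Omega)$, $\varrho_0>0$ a.e. A solution of Scheme-I is a sequence $(\varrho_h^k,\mathbf u_h^k,\mathbf B_h^k)_{0\le k\le N}$ such that $\varrho_h^0|_K=\frac1{|K|}\int_K\varrho_0$, $\mathbf u_h^0\in V_h$, $\mathbf B_h^0\in N_h$ (for instance interpolants of the initial velocity and magnetic field) and, for each $k=1,\dots,N$, $(\varrho_h,\mathbf u_h,\mathbf B_h)=(\varrho_h^k,\mathbf u_h^k,\mathbf B_h^k)\in Q_h\times V_{0,h}\times N_{0,h}$ satisfies $$\int_\Omega D_t\varrho_h\,\phi_h-\sum_{\sigma\in\mathcal E^I}\int_\sigma F_h^\varepsilon(\varrho_h,\mathbf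 u_h)[\![\phi_h]\!]=0\quad\forall\phi_h\in Q_h,$$ $$\int_\Omega D_t(\varrho_h\widehat{\mathbf u_h})\cdot\mathbf v_h-\sum_{\sigma\in\mathcal E^I}\int_\sigma F_h^\varepsilon(\varrho_h\widehat{\mathbf u_h},\mathbf u_h)\cdot[\![\widehat{\mathbf v_h}]\!]+\mu\int_\Omega\nabla_h\mathbf u_h:\nabla_h\mathbf v_h+\int_\Omega(\nu\operatorname{div}_h\mathbf u_h-p(\varrho_h))\operatorname{div}_h\mathbf v_h-\int_\Omega(\operatorname{Curl}_h\mathbf B_h\times\mathbf B_h^\triangleleft)\cdot\mathbf v_h=0\quad\forall\mathbf v_h\in V_{0,h},$$ $$\int_\Omega\big(D_t\mathbf B_h\cdot\mathbf C_h+\alpha\operatorname{Curl}_h\mathbf B_h\cdot\operatorname{Curl}_h\mathbf C_h-(\mathbf u_h\times\mathbf B_h^\triangleleft)\cdot\operatorname{Curl}_h\mathbf C_h\big)=0\quad\forall\mathbf C_h\in N_{0,h}.$$ *Claim.* For every solution and every step $k=1,\dots,N$ there are a piecewise constant $\xi$ with $\xi|_K$ between $\varrho_h^\triangleleft|_K$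 and $\varrho_h|_K$ for every element $K$, and numbers $\zeta_\sigma$ between $\varrho_h^{\rm in}$ and $\varrho_h^{\rm out}$ for every $\sigma\in\mathcal E^I$, such that $$D_t\int_\Omega\Big(\tfrac12\varrho_h|\widehat{\mathbf u_h}|^2+\mathcal H(\varrho_h)+\tfrac12|\mathbf B_h|^2\Big)+\mu\|\nabla_h\mathbf u_h\|_{L^2}^2+\nu\|\operatorname{div}_h\mathbf u_h\|_{L^2}^2+\alpha\|\operatorname{Curl}_h\mathbf B_h\|_{L^2}^2$$ $$=-\tfrac{\Delta t}2\int_\Omega\varrho_h^\triangleleft|D_t\widehat{\mathbf u_h}|^2-\tfrac{\Delta t}2\int_\Omega|D_t\mathbf B_h|^2-\tfrac{\Delta t}2\int_\Omega\mathcal H''(\xi)|D_t\varrho_h|^2$$ $$-\sum_{\sigma\in\mathcal E^I}\int_\sigma\Big(\varrho_h^{\rm up}\tfrac{|u_\sigma|}2+h^\varepsilon\{\!\{\varrho_h\}\!\}\Big)\big|[\![\widehat{\mathbf u_h}]\!]\big|^2-\sum_{\sigma\in\mathcal E^I}\int_\sigma\mathcal H''(\zeta_\sigma)[\![\varrho_h]\!]^2\Big(h^\varepsilon+\tfrac{|u_\sigma|}2\Big)\le0.$$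 Each of the five terms on the right-hand side is nonpositive; in particular the total energy $\int_\Omega(\frac12\varrho_h|\widehat{\mathbf u_h}|^2+\mathcal H(\varrho_h)+\frac12|\mathbf B_h|^2)$ does not increase from one time step to the next. -/

import Mathlib

open MeasureTheory
open scoped Matrix ContDiff

noncomputable section

namespace MHD

/-- Points and vectors of `ℝ^d`, with the Euclidean norm. -/
abbrev Pt (d : ℕ) := EuclideanSpace ℝ (Fin d)

/-! ### Meshes -/

/-- A conforming triangulation of `Ω ⊆ ℝ^d` by finitely many `d`-simplices. An element is recorded
by the set of its `d + 1` vertices, the element itself being the convex hull of that set. -/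
structure Triangulation (d : ℕ) (Ω : Set (Pt d)) where
  cells : Finset (Finset (Pt d))
  card_eq : ∀ K ∈ cells, K.card = d + 1
  indep : ∀ K ∈ cells, AffineIndependent ℝ ((↑) : K → Pt d)
  /-- Two elements meet along a common (possibly empty) subsimplex. -/
  conforming : ∀ K ∈ cells, ∀ L ∈ cells,
    convexHull ℝ (K : Set (Pt d)) ∩ convexHull ℝ (L : Set (Pt d))
      ⊆ convexHull ℝ ((K : Set (Pt d)) ∩ (L : Set (Pt d)))
  closure_eq : closure Ω = ⋃ K ∈ cells, convexHull ℝ (K : Set (Pt d))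
  interior_subset : ∀ K ∈ cells, interior (convexHull ℝ (K : Set (Pt d))) ⊆ Ω

variable {d : ℕ} {Ω : Set (Pt d)}

namespace Triangulation

/-- The elements of the triangulation. -/
abbrev Cell (T : Triangulation d Ω) := {K : Finset (Pt d) // K ∈ T.cells}

open Classical in
/-- The vertex sets of all `(d-1)`-dimensional faces of elements. -/
def faces (T : Triangulation d Ω) : Finset (Finset (Pt d)) :=
  T.cells.biUnion fun K => K.powersetCard d

/-- The `(d-1)`-dimensional faces of the triangulation. -/
abbrev Face (T : Triangulation d Ω) := {σ : Finset (Pt d) // σ ∈ T.faces}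

/-- The closed simplex occupied by an element. -/
def body (T : Triangulation d Ω) (K : T.Cell) : Set (Pt d) := convexHull ℝ (K.1 : Set (Pt d))

/-- The closed `(d-1)`-simplex occupied by a face. -/
def faceBody (T : Triangulation d Ω) (σ : T.Face) : Set (Pt d) := convexHull ℝ (σ.1 : Set (Pt d))

open Classical in
/-- Exterior faces: those contained in the boundary of `Ω`. -/
def extFaces (T : Triangulation d Ω) : Finset T.Face :=
  Finset.univ.filter fun σ => T.faceBody σ ⊆ frontier Ω

open Classical in
/-- Interior faces: all the others. -/
def intFaces (T : Triangulation d Ω) : Finset T.Face :=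
  Finset.univ.filter fun σ => ¬ T.faceBody σ ⊆ frontier Ω

/-- The mesh size: the maximal diameter of the elements. -/
def size (T : Triangulation d Ω) : ℝ := ⨆ K : T.Cell, Metric.diam (T.body K)

/-- Integral over `Ω` of a function given separately on each element. -/
def integral (T : Triangulation d Ω) (f : T.Cell → Pt d → ℝ) : ℝ :=
  ∑ K : T.Cell, ∫ x in T.body K, f K x

/-- Surface integral over a face (`(d-1)`-dimensional Hausdorff measure, normalised to agree with
the usual surface measure). -/
def faceIntegral {V : Type*} [NormedAddCommGroup V] [NormedSpace ℝ V]
    (T : Triangulation d Ω) (σ : T.Face) (f : Pt d → V) : V :=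
  ∫ x in T.faceBody σ, f x ∂(μHE[d - 1] : Measure (Pt d))

/-- The surface measure `|σ|` of a face. -/
def faceArea (T : Triangulation d Ω) (σ : T.Face) : ℝ :=
  (μHE[d - 1] : Measure (Pt d)).real (T.faceBody σ)

/-- A choice, for every face `σ`, of a unit normal `n_σ`, together with the element `inn σ`
out of which `n_σ` points and, for interior faces, the element `out σ` into which it points
(the value of `out` at an exterior face is irrelevant). Thus `f^in` and `f^out` on `σ` are the
traces taken from `inn σ` and `out σ`. -/
structure Orientation (T : Triangulation d Ω) where
  normal : T.Face → Pt d
  inn : T.Face → T.Cell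
  out : T.Face → T.Cell
  norm_normal : ∀ σ, ‖normal σ‖ = 1
  normal_orthogonal : ∀ σ, ∀ x ∈ σ.1, ∀ y ∈ σ.1, inner ℝ (normal σ) (x - y) = 0
  subset_inn : ∀ σ, σ.1 ⊆ (inn σ).1
  inner_inn : ∀ σ, ∀ y ∈ σ.1, ∀ z ∈ (inn σ).1, z ∉ σ.1 → inner ℝ (normal σ) (z - y) < 0
  subset_out : ∀ σ ∈ T.intFaces, σ.1 ⊆ (out σ).1
  inner_out : ∀ σ ∈ T.intFaces, ∀ y ∈ σ.1, ∀ z ∈ (out σ).1, z ∉ σ.1 →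
    0 < inner ℝ (normal σ) (z - y)

/-- Piecewise constant functions `Q_h`: one value per element. -/
abbrev PwConst (T : Triangulation d Ω) := T.Cell → ℝ

/-- Piecewise (discontinuous) affine vector fields: one affine vector field per element. -/
abbrev PwAffine (T : Triangulation d Ω) := T.Cell → (Pt d →ᵃ[ℝ] Pt d)

end Triangulation

/-! ### Vector calculus in dimensions two and three -/

/-- The inclusion `ℝ^d → ℝ^3` for `d ≤ 3` (for `d = 2` the third component is zero); cross products
and curls of planar vectors are those of the corresponding vectors of `ℝ^3`. -/
def toR3 (v : Pt d) : Fin 3 → ℝ := fun i => if h : i.1 < d then v ⟨i.1, h⟩ else 0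

/-- The `j`-th coordinate direction of `ℝ^3` as a direction of `ℝ^d`; for `d = 2` it is zero
for the third direction: nothing depends on the third variable. -/
def dir (d : ℕ) (j : Fin 3) : Pt d :=
  if h : j.1 < d then EuclideanSpace.single ⟨j.1, h⟩ (1 : ℝ) else 0

/-- The curl of a field with values in `ℝ^3` whose differential at the point is `A`:
`(Curl F)_i = ∂_{i+1} F_{i+2} - ∂_{i+2} F_{i+1}`, indices modulo three. -/
def curlOf (A : Pt d → Fin 3 → ℝ) : Fin 3 → ℝ :=
  fun i => A (dir d (i + 1)) (i + 2) - A (dir d (i + 2)) (i + 1)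

/-- The partial derivative `∂_j v_i` of an affine vector field. -/
def partialDeriv (v : Pt d →ᵃ[ℝ] Pt d) (i j : Fin d) : ℝ :=
  v.linear (EuclideanSpace.single j (1 : ℝ)) i

/-- `∇v : ∇w` for affine vector fields. -/
def gradInner (v w : Pt d →ᵃ[ℝ] Pt d) : ℝ := ∑ i, ∑ j, partialDeriv v i j * partialDeriv w i j

/-- The divergence of an affine vector field. -/
def divg (v : Pt d →ᵃ[ℝ] Pt d) : ℝ := ∑ i, partialDeriv v i i

/-- The curl of an affine vector field. -/
def curl (v : Pt d →ᵃ[ℝ] Pt d) : Fin 3 → ℝ := curlOf fun e => toR3 (v.linear e)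

/-! ### Discrete spaces -/

namespace Triangulation

variable (T : Triangulation d Ω)

/-- The Crouzeix--Raviart space `V_h`. -/
def crouzeixRaviart (O : T.Orientation) : Set T.PwAffine :=
  {v | ∀ σ ∈ T.intFaces, T.faceIntegral σ (fun x => v (O.out σ) x - v (O.inn σ) x) = 0}

/-- The subspace of `V_h` of fields with zero mean on the exterior faces. -/
def crouzeixRaviart₀ (O : T.Orientation) : Set T.PwAffine :=
  {v | v ∈ T.crouzeixRaviart O ∧
    ∀ σ ∈ T.extFaces, ∀ K : T.Cell, σ.1 ⊆ K.1 → T.faceIntegral σ (fun x => v K x) = 0}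

/-- `Curl v ∈ L^2(Ω)` in the sense of distributions. -/
def HasL2Curl (v : T.PwAffine) : Prop :=
  ∃ g : Pt d → Fin 3 → ℝ, MemLp g 2 (volume.restrict Ω) ∧
    ∀ φ : Pt d → Fin 3 → ℝ, ContDiff ℝ ∞ φ → HasCompactSupport φ → tsupport φ ⊆ Ω →
      T.integral (fun K x => toR3 (v K x) ⬝ᵥ curlOf (fderiv ℝ φ x)) = ∫ x in Ω, g x ⬝ᵥ φ x

/-- The lowest order Nédélec edge element space `N_h`: on every element the field is `a + S x` with
a constant vector `a` and a skew-symmetric matrix `S` (that is, `a + b × x` if `d = 3` and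
`a + b x^⊥` if `d = 2`). -/
def nedelec (O : T.Orientation) : Set T.PwAffine :=
  {v | (∀ K x, inner ℝ ((v K).linear x) x = 0) ∧ T.HasL2Curl v ∧
    ∀ σ ∈ T.intFaces, T.faceIntegral σ
      (fun x => crossProduct (toR3 (v (O.out σ) x - v (O.inn σ) x)) (toR3 (O.normal σ))) = 0}

/-- The subspace of `N_h` of fields whose tangential part has zero mean on the exterior faces. -/
def nedelec₀ (O : T.Orientation) : Set T.PwAffine :=
  {v | v ∈ T.nedelec O ∧ ∀ σ ∈ T.extFaces, ∀ K : T.Cell, σ.1 ⊆ K.1 →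
    T.faceIntegral σ (fun x => crossProduct (toR3 (v K x)) (toR3 (O.normal σ))) = 0}

/-! ### Discrete operators -/

/-- The projection onto piecewise constants: the mean value of a field on each element. -/
def cellMean (v : T.PwAffine) : T.Cell → Pt d := fun K => ⨍ x in T.body K, v K x

/-- The jump `f^out - f^in` of a piecewise constant function across a face. -/
def jump {T : Triangulation d Ω} {V : Type*} [AddCommGroup V] (O : T.Orientation)
    (f : T.Cell → V) (σ : T.Face) : V := f (O.out σ) - f (O.inn σ)

/-- The average of a piecewise constant function at a face. -/
def avg {T : Triangulation d Ω} (O : T.Orientation) (f : T.PwConst) (σ : T.Face) : ℝ :=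
  (f (O.out σ) + f (O.inn σ)) / 2

/-- The mean normal velocity `u_σ` through a face. -/
def faceVel (O : T.Orientation) (u : T.PwAffine) (σ : T.Face) : ℝ :=
  (1 / T.faceArea σ) * inner ℝ (T.faceIntegral σ fun x => u (O.inn σ) x) (O.normal σ)

/-- The upwind value `r^up` at a face. -/
def upwind (O : T.Orientation) (r : T.PwConst) (u : T.PwAffine) (σ : T.Face) : ℝ :=
  if 0 ≤ T.faceVel O u σ then r (O.inn σ) else r (O.out σ)

/-- The diffusive upwind flux `r^in [u_σ]^+ + r^out [u_σ]^- - h^ε (r^out - r^in)`. -/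
def flux {V : Type*} [AddCommGroup V] [Module ℝ V] (O : T.Orientation) (ε : ℝ)
    (r : T.Cell → V) (u : T.PwAffine) (σ : T.Face) : V :=
  ((T.faceVel O u σ + |T.faceVel O u σ|) / 2) • r (O.inn σ)
    + ((T.faceVel O u σ - |T.faceVel O u σ|) / 2) • r (O.out σ)
    - (T.size ^ ε) • jump O r σ

end Triangulation

/-! ### The scheme -/

/-- Physical and numerical parameters: viscosities `μ > 0`, `λ ≥ 0`, resistivity `α > 0`, pressure
law `p(ϱ) = a ϱ^γ` with `a > 0`, `γ > 1`, artificial diffusion exponent `ε > 0` and time step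
`Δt > 0`. -/
structure Params where
  mu : ℝ
  lam : ℝ
  alpha : ℝ
  a : ℝ
  gamma : ℝ
  eps : ℝ
  dt : ℝ
  mu_pos : 0 < mu
  lam_nonneg : 0 ≤ lam
  alpha_pos : 0 < alpha
  a_pos : 0 < a
  one_lt_gamma : 1 < gamma
  eps_pos : 0 < eps
  dt_pos : 0 < dt

namespace Params

/-- `ν = (d-2)/d μ + λ`. -/
def nu (P : Params) (d : ℕ) : ℝ := ((d : ℝ) - 2) / d * P.mu + P.lam

/-- The pressure `p(r) = a r^γ`. -/
def pressure (P : Params) (r : ℝ) : ℝ := P.a * r ^ P.gamma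

/-- The pressure potential `H(r) = a/(γ-1) r^γ`. -/
def potential (P : Params) (r : ℝ) : ℝ := P.a / (P.gamma - 1) * r ^ P.gamma

/-- The second derivative `H''`. -/
def potential'' (P : Params) (r : ℝ) : ℝ := iteratedDeriv 2 P.potential r

/-- The backward Euler difference quotient `(new - old) / Δt`. -/
def Dt {V : Type*} [AddCommGroup V] [Module ℝ V] (P : Params) (old new : V) : V :=
  P.dt⁻¹ • (new - old)

end Params

namespace Triangulation

variable (T : Triangulation d Ω)

/-- The discrete continuity equation for the step from the density `ρ'` to `(ρ, u)`. -/
def ContinuityEq (O : T.Orientation) (P : Params) (ρ' ρ : T.PwConst) (u : T.PwAffine) : Prop :=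
  ∀ φ : T.PwConst,
    T.integral (fun K _ => P.Dt (ρ' K) (ρ K) * φ K)
      - ∑ σ ∈ T.intFaces, T.faceIntegral σ (fun _ => T.flux O P.eps ρ u σ * jump O φ σ) = 0

/-- The discrete momentum equation for the step from `(ρ', u', B')` to `(ρ, u, B)`. -/
def MomentumEq (O : T.Orientation) (P : Params) (ρ' ρ : T.PwConst) (u' u B' B : T.PwAffine) :
    Prop :=
  ∀ v ∈ T.crouzeixRaviart₀ O,
    T.integral (fun K x =>
        inner ℝ (P.Dt (ρ' K • T.cellMean u' K) (ρ K • T.cellMean u K)) (v K x))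
      - ∑ σ ∈ T.intFaces, T.faceIntegral σ (fun _ =>
          inner ℝ (T.flux O P.eps (fun K => ρ K • T.cellMean u K) u σ) (jump O (T.cellMean v) σ))
      + P.mu * T.integral (fun K _ => gradInner (u K) (v K))
      + T.integral (fun K _ => (P.nu d * divg (u K) - P.pressure (ρ K)) * divg (v K))
      - T.integral (fun K x => crossProduct (curl (B K)) (toR3 (B' K x)) ⬝ᵥ toR3 (v K x)) = 0

/-- The discrete Maxwell equation for the step from `B'` to `(u, B)`. -/
def MaxwellEq (O : T.Orientation) (P : Params) (u B' B : T.PwAffine) : Prop :=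
  ∀ C ∈ T.nedelec₀ O,
    T.integral (fun K x => inner ℝ (P.Dt (B' K x) (B K x)) (C K x)
      + P.alpha * (curl (B K) ⬝ᵥ curl (C K))
      - crossProduct (toR3 (u K x)) (toR3 (B' K x)) ⬝ᵥ curl (C K)) = 0

/-- `(ρ^k, u^k, B^k)`, `k = 0, …, N`, is a solution of the scheme on `N` time steps with initial
density `ρ₀`. The discrete initial velocity and magnetic field may be any members of `V_h` and `N_h`,
so that every choice of interpolants of the initial data is covered. -/
structure IsSolution (O : T.Orientation) (P : Params) (N : ℕ) (ρ₀ : Pt d → ℝ)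
    (ρ : ℕ → T.PwConst) (u B : ℕ → T.PwAffine) : Prop where
  init_density : ∀ K, ρ 0 K = ⨍ x in T.body K, ρ₀ x
  init_velocity : u 0 ∈ T.crouzeixRaviart O
  init_magnetic : B 0 ∈ T.nedelec O
  velocity_mem : ∀ k < N, u (k + 1) ∈ T.crouzeixRaviart₀ O
  magnetic_mem : ∀ k < N, B (k + 1) ∈ T.nedelec₀ O
  continuity : ∀ k < N, T.ContinuityEq O P (ρ k) (ρ (k + 1)) (u (k + 1))
  momentum : ∀ k < N, T.MomentumEq O P (ρ k) (ρ (k + 1)) (u k) (u (k + 1)) (B k) (B (k + 1))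
  maxwell : ∀ k < N, T.MaxwellEq O P (u (k + 1)) (B k) (B (k + 1))

/-! ### Energy and dissipation -/

/-- The total energy: kinetic, internal and magnetic. -/
def energy (P : Params) (ρ : T.PwConst) (u B : T.PwAffine) : ℝ :=
  T.integral fun K x =>
    1 / 2 * ρ K * ‖T.cellMean u K‖ ^ 2 + P.potential (ρ K) + 1 / 2 * ‖B K x‖ ^ 2

/-- `μ ‖∇_h u‖² + ν ‖div_h u‖² + α ‖Curl_h B‖²`, with `L^2(Ω)` norms. -/
def physicalDissipation (P : Params) (u B : T.PwAffine) : ℝ :=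
  P.mu * T.integral (fun K _ => gradInner (u K) (u K))
    + P.nu d * T.integral (fun K _ => divg (u K) ^ 2)
    + P.alpha * T.integral (fun K _ => curl (B K) ⬝ᵥ curl (B K))

/-- Time-step dissipation of the velocity. -/
def timeDissVelocity (P : Params) (ρ' : T.PwConst) (u' u : T.PwAffine) : ℝ :=
  P.dt / 2 * T.integral fun K _ => ρ' K * ‖P.Dt (T.cellMean u' K) (T.cellMean u K)‖ ^ 2

/-- Time-step dissipation of the magnetic field. -/
def timeDissMagnetic (P : Params) (B' B : T.PwAffine) : ℝ :=
  P.dt / 2 * T.integral fun K x => ‖P.Dt (B' K x) (B K x)‖ ^ 2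

/-- Time-step dissipation of the density. -/
def timeDissDensity (P : Params) (ξ ρ' ρ : T.PwConst) : ℝ :=
  P.dt / 2 * T.integral fun K _ => P.potential'' (ξ K) * |P.Dt (ρ' K) (ρ K)| ^ 2

/-- Upwind and jump dissipation of the velocity. -/
def jumpDissVelocity (O : T.Orientation) (P : Params) (ρ : T.PwConst) (u : T.PwAffine) : ℝ :=
  ∑ σ ∈ T.intFaces, T.faceIntegral σ fun _ =>
    (T.upwind O ρ u σ * (|T.faceVel O u σ| / 2) + T.size ^ P.eps * avg O ρ σ)
      * ‖jump O (T.cellMean u) σ‖ ^ 2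

/-- Upwind and jump dissipation of the density. -/
def jumpDissDensity (O : T.Orientation) (P : Params) (ζ : T.Face → ℝ) (ρ : T.PwConst)
    (u : T.PwAffine) : ℝ :=
  ∑ σ ∈ T.intFaces, T.faceIntegral σ fun _ =>
    P.potential'' (ζ σ) * jump O ρ σ ^ 2 * (T.size ^ P.eps + |T.faceVel O u σ| / 2)

end Triangulation

end MHD

end

/-!
The balance comes from testing the three discrete equations with the unknowns themselves: the
continuity equation with `H'(ρ)` and with `|û|² / 2`, the momentum equation with `u`, the Maxwell
equation with `B`. The work of the Lorentz force appears with opposite signs in the last two and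
cancels. The work of the pressure cancels because `r H'(r) - H(r) = p(r)` turns the centred part of
the flux tested with `H'(ρ)` into `∑ ∫_σ u_σ ⟦p(ρ)⟧`, and for Crouzeix–Raviart fields the
elementwise divergence theorem gives `∫ p div u = -∑ ∫_σ u_σ ⟦p⟧` for piecewise constant `p`.
Squares are expanded exactly in time and across faces, while second order Taylor expansions of `H`
yield the intermediate values `ξ` and `ζ`; the upwind and artificial diffusion contributions to
`ζ` are merged by the intermediate value theorem for `H''`. Expanding at positive values only is
legitimate because testing the continuity equation with the indicator of `{ρ ≤ 0}` shows that
positivity of the density propagates.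
-/

namespace MHD

open Module

section Barycentric

variable {k ι V E : Type*} [Ring k] [AddCommGroup V] [Module k V] [AddCommGroup E] [Module k E]

lemma affineMap_apply_eq_sum_coord_smul [Fintype ι] (b : AffineBasis ι k V) (f : V →ᵃ[k] E)
    (q : V) : f q = ∑ i, b.coord i q • f (b i) := by
  conv_lhs => rw [← b.affineCombination_coord_eq_self q]
  rw [Finset.map_affineCombination _ _ _ (b.sum_coord_apply_eq_one q),
    Finset.affineCombination_eq_linear_combination _ _ _ (b.sum_coord_apply_eq_one q)]
  rfl

lemma affineMap_linear_eq_sum_coord_linear_smul [Fintype ι] (b : AffineBasis ι k V)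
    (f : V →ᵃ[k] E) (w : V) : f.linear w = ∑ i, (b.coord i).linear w • f (b i) := by
  simp only [AffineMap.decomp', Pi.sub_apply, sub_smul, Finset.sum_sub_distrib,
    ← affineMap_apply_eq_sum_coord_smul]

lemma sum_coord_linear_eq_zero [Fintype ι] (b : AffineBasis ι k V) (w : V) :
    ∑ i, (b.coord i).linear w = 0 := by
  have h := affineMap_linear_eq_sum_coord_linear_smul b (AffineMap.const k V (1 : k)) w
  simpa using h.symm

lemma trace_linear_eq_sum_coord_linear {R : Type*} [CommRing R] [Module R V] [Module.Free R V]
    [Module.Finite R V] [Fintype ι] (b : AffineBasis ι R V) (f : V →ᵃ[R] V) :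
    LinearMap.trace R V f.linear = ∑ i, (b.coord i).linear (f (b i)) := by
  have hf : f.linear = ∑ i, dualTensorHom R V V ((b.coord i).linear ⊗ₜ f (b i)) := by
    ext w
    simpa using affineMap_linear_eq_sum_coord_linear_smul b f w
  rw [hf, map_sum]
  simp only [LinearMap.trace_eq_contract_apply, contractLeft_apply]

/-- The affine involution exchanging the vertices `b i` and `b j` of a simplex and fixing all the
others. -/
noncomputable def vertexSwap (b : AffineBasis ι k V) (i j : ι) : V →ᵃ[k] V :=
  AffineMap.id k V + ((LinearMap.toSpanSingleton k V (b j - b i)).toAffineMap.comp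
    (b.coord i - b.coord j))

lemma vertexSwap_apply (b : AffineBasis ι k V) (i j : ι) (x : V) :
    vertexSwap b i j x = x + (b.coord i x - b.coord j x) • (b j - b i) := by
  simp [vertexSwap, sub_smul]

lemma coord_vertexSwap [DecidableEq ι] (b : AffineBasis ι k V) (i j l : ι) (x : V) :
    b.coord l (vertexSwap b i j x) = b.coord (Equiv.swap i j l) x := by
  have h : b.coord l (vertexSwap b i j x)
      = (b.coord i x - b.coord j x) * (b.coord l (b j) - b.coord l (b i)) + b.coord l x := by
    have hsub := (b.coord l).linearMap_vsub (b j) (b i)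
    simp only [vsub_eq_sub] at hsub
    rw [vertexSwap_apply, add_comm x, ← vadd_eq_add, AffineMap.map_vadd, map_smul, hsub]
    rfl
  rw [h]
  simp only [b.coord_apply, Equiv.swap_apply_def]
  split_ifs <;> simp_all

lemma involutive_vertexSwap [Finite ι] (b : AffineBasis ι k V) (i j : ι) :
    Function.Involutive (vertexSwap b i j) := by
  classical
  intro x
  exact b.ext_elem fun l => by simp [coord_vertexSwap]

lemma vertexSwap_preimage_convexHull {ι V : Type*} [AddCommGroup V] [Module ℝ V]
    (b : AffineBasis ι ℝ V) (i j : ι) :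
    vertexSwap b i j ⁻¹' convexHull ℝ (Set.range b) = convexHull ℝ (Set.range b) := by
  classical
  ext x
  simp only [b.convexHull_eq_nonneg_coord, Set.mem_preimage, Set.mem_ofPred_eq, coord_vertexSwap]
  exact (Equiv.swap i j).forall_congr_right (q := fun l => 0 ≤ b.coord l x)

end Barycentric

section Haar

variable {V E : Type*} [NormedAddCommGroup V] [NormedSpace ℝ V] [FiniteDimensional ℝ V]
  [MeasurableSpace V] [BorelSpace V] (μ : Measure V) [μ.IsAddHaarMeasure]

lemma measurePreserving_of_involutive {f : V →ᵃ[ℝ] V} (hf : Function.Involutive f) :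
    MeasurePreserving f μ μ := by
  have hlin : f.linear ∘ₗ f.linear = LinearMap.id := by
    rw [← AffineMap.comp_linear, show f.comp f = AffineMap.id ℝ V from AffineMap.ext hf,
      AffineMap.id_linear]
  have hdet : LinearMap.det f.linear * LinearMap.det f.linear = 1 := by
    rw [← LinearMap.det_comp, hlin, LinearMap.det_id]
  have hlin_mp : MeasurePreserving f.linear μ μ := by
    refine ⟨f.linear.continuous_of_finiteDimensional.measurable, ?_⟩
    rw [Measure.map_linearMap_addHaar_eq_smul_addHaar μ (left_ne_zero_of_mul_eq_one hdet)]
    rcases mul_self_eq_one_iff.1 hdet with h | h <;> simp [h]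
  have hdecomp : ⇑f = (· + f 0) ∘ f.linear := by
    rw [AffineMap.decomp f]
    ext; simp
  rw [hdecomp]
  exact (measurePreserving_add_right μ (f 0)).comp hlin_mp

variable {ι : Type*} (b : AffineBasis ι ℝ V)

lemma setIntegral_convexHull_coord_eq [Finite ι] (i j : ι) :
    ∫ x in convexHull ℝ (Set.range b), b.coord i x ∂μ
      = ∫ x in convexHull ℝ (Set.range b), b.coord j x ∂μ := by
  classical
  have hmp := measurePreserving_of_involutive μ (involutive_vertexSwap b i j)
  have hemb : MeasurableEmbedding (vertexSwap b i j) :=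
    (MeasurableEquiv.ofInvolutive _ (involutive_vertexSwap b i j)
      hmp.measurable).measurableEmbedding
  rw [← hmp.setIntegral_preimage_emb hemb, vertexSwap_preimage_convexHull]
  simp only [coord_vertexSwap, Equiv.swap_apply_left]

lemma integrableOn_convexHull_coord [Finite ι] (i : ι) :
    IntegrableOn (b.coord i) (convexHull ℝ (Set.range b)) μ :=
  (b.coord i).continuous_of_finiteDimensional.continuousOn.integrableOn_compact
    ((Set.finite_range b).isCompact_convexHull ℝ)

variable [Fintype ι]

lemma setIntegral_convexHull_coord (i : ι) :
    ∫ x in convexHull ℝ (Set.range b), b.coord i x ∂μ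
      = μ.real (convexHull ℝ (Set.range b)) / Fintype.card ι := by
  have : Nonempty ι := ⟨i⟩
  have hsum : ∑ j, ∫ x in convexHull ℝ (Set.range b), b.coord j x ∂μ
      = μ.real (convexHull ℝ (Set.range b)) := by
    rw [← integral_finsetSum _ fun j _ => integrableOn_convexHull_coord μ b j]
    simp
  rw [Finset.sum_congr rfl fun j _ => setIntegral_convexHull_coord_eq μ b j i] at hsum
  rw [eq_div_iff (Nat.cast_ne_zero.2 Fintype.card_ne_zero), ← hsum]
  simp [mul_comm]

lemma setIntegral_convexHull_affineMap [NormedAddCommGroup E] [NormedSpace ℝ E] [CompleteSpace E]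
    (f : V →ᵃ[ℝ] E) :
    ∫ x in convexHull ℝ (Set.range b), f x ∂μ
      = (μ.real (convexHull ℝ (Set.range b)) / Fintype.card ι) • ∑ i, f (b i) := by
  calc ∫ x in convexHull ℝ (Set.range b), f x ∂μ
      = ∫ x in convexHull ℝ (Set.range b), ∑ i, b.coord i x • f (b i) ∂μ := by
        simp only [← affineMap_apply_eq_sum_coord_smul]
    _ = ∑ i, (∫ x in convexHull ℝ (Set.range b), b.coord i x ∂μ) • f (b i) := by
        rw [integral_finsetSum _ fun i _ => (integrableOn_convexHull_coord μ b i).smul_const _]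
        simp only [integral_smul_const]
    _ = _ := by simp only [setIntegral_convexHull_coord, Finset.smul_sum]

end Haar

section Simplex

variable {V E : Type*} [NormedAddCommGroup V] [InnerProductSpace ℝ V] {n : ℕ} {s : Finset V}

lemma exists_isometric_chart (hs : AffineIndependent ℝ ((↑) : s → V)) (hcard : s.card = n + 1) :
    ∃ (W : Submodule ℝ V) (b : AffineBasis s ℝ W) (L : W →ᵃⁱ[ℝ] V),
      finrank ℝ W = n ∧ (∀ x, L (b x) = x) ∧
        L '' convexHull ℝ (Set.range b) = convexHull ℝ (s : Set V) := by
  obtain ⟨p, hp⟩ : s.Nonempty := Finset.card_pos.1 (by omega)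
  set W := vectorSpan ℝ (Set.range ((↑) : s → V))
  have hdim : finrank ℝ W = n := hs.finrank_vectorSpan (by simpa using hcard)
  let L : W →ᵃⁱ[ℝ] V :=
    (AffineIsometryEquiv.constVAdd ℝ V p).toAffineIsometry.comp W.subtypeₗᵢ.toAffineIsometry
  have hmem : ∀ x : s, (x : V) - p ∈ W := fun x =>
    vsub_mem_vectorSpan ℝ (Set.mem_range_self x) ⟨⟨p, hp⟩, rfl⟩
  let v : s → W := fun x => ⟨x - p, hmem x⟩
  have hLv : ∀ x, L (v x) = x := fun x => add_sub_cancel p (x : V)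
  have hind : AffineIndependent ℝ v :=
    AffineIndependent.of_comp L.toAffineMap ((funext hLv : ⇑L ∘ v = (↑)) ▸ hs)
  have hspan : affineSpan ℝ (Set.range v) = ⊤ := by
    rw [hind.affineSpan_eq_top_iff_card_eq_finrank_add_one, hdim]
    simpa using hcard
  refine ⟨W, ⟨v, hind, hspan⟩, L, hdim, hLv, ?_⟩
  calc L '' convexHull ℝ (Set.range v) = convexHull ℝ (Set.range (L ∘ v)) := by
        rw [Set.range_comp]
        exact L.toAffineMap.image_convexHull _
    _ = convexHull ℝ (s : Set V) := by rw [(funext hLv : ⇑L ∘ v = (↑)), Subtype.range_coe]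

lemma setIntegral_image_isometry {X Y : Type*} [MetricSpace X] [MeasurableSpace X] [BorelSpace X]
    [CompleteSpace X] [MetricSpace Y] [MeasurableSpace Y] [BorelSpace Y]
    [NormedAddCommGroup E] [NormedSpace ℝ E] {g : X → Y} (hg : Isometry g) (n : ℕ) {t : Set X}
    (ht : MeasurableSet t) (f : Y → E) :
    ∫ y in g '' t, f y ∂μHE[n] = ∫ x in t, f (g x) ∂μHE[n] := by
  have hemb := hg.isClosedEmbedding.measurableEmbedding
  have hrestrict : (μHE[n] : Measure Y).restrict (g '' t)
      = (Measure.map g μHE[n]).restrict (g '' t) := by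
    rw [hg.map_euclideanHausdorffMeasure,
      Measure.restrict_restrict (hemb.measurableSet_image.2 ht),
      Set.inter_eq_left.2 (Set.image_subset_range g t)]
  rw [hrestrict, hemb.setIntegral_map, hg.injective.preimage_image]

variable [MeasurableSpace V] [BorelSpace V]

lemma euclideanHausdorffMeasure_convexHull_lt_top (hs : AffineIndependent ℝ ((↑) : s → V))
    (hcard : s.card = n + 1) : (μHE[n] : Measure V) (convexHull ℝ (s : Set V)) < ⊤ := by
  obtain ⟨W, b, L, rfl, -, himage⟩ := exists_isometric_chart hs hcard
  have := b.finiteDimensional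
  rw [← himage, L.isometry.euclideanHausdorffMeasure_image]
  exact ((Set.finite_range b).isCompact_convexHull ℝ).measure_lt_top

lemma integrableOn_convexHull_finset_of_continuous [NormedAddCommGroup E]
    (hs : AffineIndependent ℝ ((↑) : s → V)) (hcard : s.card = n + 1) {f : V → E}
    (hf : Continuous f) : IntegrableOn f (convexHull ℝ (s : Set V)) μHE[n] :=
  have hcompact := s.finite_toSet.isCompact_convexHull ℝ
  hf.continuousOn.integrableOn_of_subset_isCompact hcompact hcompact.measurableSet subset_rfl
    (euclideanHausdorffMeasure_convexHull_lt_top hs hcard).ne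

lemma setIntegral_convexHull_finset_affineMap [NormedAddCommGroup E] [NormedSpace ℝ E]
    [CompleteSpace E] (hs : AffineIndependent ℝ ((↑) : s → V)) (hcard : s.card = n + 1)
    (f : V →ᵃ[ℝ] E) :
    ∫ x in convexHull ℝ (s : Set V), f x ∂μHE[n]
      = ((μHE[n] : Measure V).real (convexHull ℝ (s : Set V)) / (n + 1)) • ∑ x ∈ s, f x := by
  obtain ⟨W, b, L, rfl, hLb, himage⟩ := exists_isometric_chart hs hcard
  have := b.finiteDimensional
  have hmeas := ((Set.finite_range b).isCompact_convexHull ℝ).measurableSet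
  have hmean := setIntegral_convexHull_affineMap μHE[finrank ℝ W] b (f.comp L.toAffineMap)
  rw [← himage, setIntegral_image_isometry L.isometry _ hmeas, measureReal_def,
    L.isometry.euclideanHausdorffMeasure_image, ← Finset.sum_coe_sort s (fun x => f x)]
  simpa [hLb, hcard, measureReal_def] using hmean

end Simplex

lemma affineMap_eq_of_mem_convexHull {V E : Type*} [AddCommGroup V] [Module ℝ V] [AddCommGroup E]
    [Module ℝ E] {f : V →ᵃ[ℝ] E} {s : Set V} {c : E} (hf : ∀ y ∈ s, f y = c) {y : V}
    (hy : y ∈ convexHull ℝ s) : f y = c :=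
  convexHull_min (t := f ⁻¹' {c}) hf ((convex_singleton c).affine_preimage f) hy

lemma convexHull_insert_eq_iUnion_homothety {V : Type*} [AddCommGroup V] [Module ℝ V] {s : Set V}
    (hs : s.Nonempty) (x : V) :
    convexHull ℝ (insert x s)
      = ⋃ t ∈ Set.Icc (0 : ℝ) 1, AffineMap.homothety x t '' convexHull ℝ s := by
  ext z
  simp only [convexHull_insert hs, convexJoin_singleton_left, segment_eq_image_lineMap,
    AffineMap.homothety_eq_lineMap, Set.mem_iUnion, Set.mem_image, exists_prop]
  tauto

section Cone

variable {V : Type*} [NormedAddCommGroup V] [InnerProductSpace ℝ V] {s : Set V} {v x : V}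

lemma mem_mk'_orthogonal_iff (r : ℝ) (z : V) :
    z ∈ AffineSubspace.mk' (r • v +ᵥ x) (ℝ ∙ v)ᗮ ↔ inner ℝ v (z - x) = r * ‖v‖ ^ 2 := by
  rw [AffineSubspace.mem_mk', Submodule.mem_orthogonal_singleton_iff_inner_right, vsub_eq_sub,
    vadd_eq_add, add_comm, ← sub_sub, inner_sub_right, inner_smul_right,
    real_inner_self_eq_norm_sq, sub_eq_zero]

lemma cone_inter_mk'_orthogonal (hs : s.Nonempty) (hv : v ≠ 0)
    (haltitude : ∀ y ∈ s, inner ℝ v (y - x) = ‖v‖ ^ 2) (r : ℝ) :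
    convexHull ℝ (insert x s) ∩ AffineSubspace.mk' (r • v +ᵥ x) (ℝ ∙ v)ᗮ
      = if r ∈ Set.Icc (0 : ℝ) 1 then AffineMap.homothety x r '' convexHull ℝ s else ∅ := by
  let height : V →ᵃ[ℝ] ℝ := (innerₗ V v).toAffineMap.comp (AffineMap.id ℝ V - AffineMap.const ℝ V x)
  have hheight : ∀ y ∈ convexHull ℝ s, ∀ t : ℝ,
      inner ℝ v (AffineMap.homothety x t y - x) = t * ‖v‖ ^ 2 := fun y hy t => by
    have hy' : inner ℝ v (y - x) = ‖v‖ ^ 2 :=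
      affineMap_eq_of_mem_convexHull (f := height) haltitude hy
    rw [AffineMap.homothety_apply, vsub_eq_sub, vadd_eq_add, add_sub_cancel_right,
      inner_smul_right, hy']
  have hnorm : ‖v‖ ^ 2 ≠ 0 := by simpa using hv
  ext z
  simp only [Set.mem_inter_iff, SetLike.mem_coe, mem_mk'_orthogonal_iff,
    convexHull_insert_eq_iUnion_homothety hs, Set.mem_iUnion, exists_prop]
  constructor
  · rintro ⟨⟨t, ht, y, hy, rfl⟩, hz⟩
    rw [hheight y hy, mul_left_inj' hnorm] at hz
    rw [← hz, if_pos ht]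
    exact ⟨y, hy, rfl⟩
  · split_ifs with hr
    · rintro ⟨y, hy, rfl⟩
      exact ⟨⟨r, hr, y, hy, rfl⟩, hheight y hy r⟩
    · exact False.elim

lemma lintegral_Icc_ofReal_pow (m : ℕ) :
    ∫⁻ r in Set.Icc (0 : ℝ) 1, ENNReal.ofReal (r ^ m) = ENNReal.ofReal (1 / (m + 1)) := by
  rw [← ofReal_integral_eq_lintegral_ofReal]
  · rw [integral_Icc_eq_integral_Ioc, ← intervalIntegral.integral_of_le zero_le_one, integral_pow]
    simp
  · exact (continuous_pow m).continuousOn.integrableOn_compact isCompact_Icc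
  · filter_upwards [ae_restrict_mem measurableSet_Icc] with r hr using pow_nonneg hr.1 _

variable [FiniteDimensional ℝ V] [MeasurableSpace V] [BorelSpace V] {m : ℕ}

lemma volume_cone (hV : finrank ℝ V = m + 1) (hs : s.Nonempty) (hfinite : s.Finite) (hv : v ≠ 0)
    (haltitude : ∀ y ∈ s, inner ℝ v (y - x) = ‖v‖ ^ 2) :
    volume.real (convexHull ℝ (insert x s))
      = ‖v‖ / (m + 1) * (μHE[m] : Measure V).real (convexHull ℝ s) := by
  have hmeas : MeasurableSet (convexHull ℝ (insert x s)) :=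
    ((hfinite.insert x).isCompact_convexHull ℝ).measurableSet
  have hsection : ∀ᵐ r : ℝ, μHE[m] (convexHull ℝ (insert x s) ∩
      AffineSubspace.mk' (r • v +ᵥ x) (ℝ ∙ v)ᗮ) = (Set.Icc (0 : ℝ) 1).indicator
        (fun r => ENNReal.ofReal (r ^ m) * μHE[m] (convexHull ℝ s)) r := by
    filter_upwards [(by simp [ae_iff] : ∀ᵐ r : ℝ, r ≠ 0)] with r hr0
    rw [cone_inter_mk'_orthogonal hs hv haltitude]
    split_ifs with hr
    · rw [Set.indicator_of_mem hr, euclideanHausdorffMeasure_homothety_image _ _ hr0,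
        ENNReal.smul_def, smul_eq_mul, ← Real.toNNReal_eq_nnnorm_of_nonneg hr.1,
        ← Real.toNNReal_pow hr.1, ENNReal.ofReal]
    · rw [Set.indicator_of_notMem hr, measure_empty]
  have hslices := EuclideanGeometry.euclideanHausdorffMeasure_eq_lintegral x hv hmeas
  rw [InnerProductSpace.euclideanHausdorffMeasure_eq_volume, hV, Nat.add_sub_cancel,
    lintegral_congr_ae hsection, lintegral_indicator measurableSet_Icc,
    lintegral_mul_const _ (by fun_prop), lintegral_Icc_ofReal_pow] at hslices
  rw [measureReal_def, hslices, ENNReal.toReal_mul, ENNReal.toReal_mul,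
    ENNReal.toReal_ofReal (by positivity), toReal_enorm, measureReal_def]
  ring

end Cone

/-- The barycentric coordinate system whose base points are the vertices of a full-dimensional
simplex, indexed by the vertices themselves. -/
noncomputable def simplexBasis {k V : Type*} [DivisionRing k] [AddCommGroup V] [Module k V]
    [FiniteDimensional k V] {s : Finset V} (hs : AffineIndependent k ((↑) : s → V))
    (hcard : s.card = finrank k V + 1) : AffineBasis s k V where
  toFun := (↑)
  ind' := hs
  tot' := by
    rw [hs.affineSpan_eq_top_iff_card_eq_finrank_add_one]
    simpa using hcard

@[simp]
lemma simplexBasis_apply {k V : Type*} [DivisionRing k] [AddCommGroup V] [Module k V]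
    [FiniteDimensional k V] {s : Finset V} (hs : AffineIndependent k ((↑) : s → V))
    (hcard : s.card = finrank k V + 1) (x : s) : simplexBasis hs hcard x = x :=
  rfl

lemma range_simplexBasis {k V : Type*} [DivisionRing k] [AddCommGroup V] [Module k V]
    [FiniteDimensional k V] {s : Finset V} (hs : AffineIndependent k ((↑) : s → V))
    (hcard : s.card = finrank k V + 1) : Set.range (simplexBasis hs hcard) = s := by
  ext x
  simp

section Divergence

variable {V : Type*} [NormedAddCommGroup V] [InnerProductSpace ℝ V]

lemma inner_eq_mul_coord_linear {ι : Type*} [Finite ι] (b : AffineBasis ι ℝ V) {n : V} {i j : ι}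
    (horth : ∀ l ≠ i, inner ℝ n (b l - b j) = 0) (w : V) :
    inner ℝ n w = inner ℝ n (b i - b j) * (b.coord i).linear w := by
  have := Fintype.ofFinite ι
  let f : V →ᵃ[ℝ] ℝ := (innerₗ V n).toAffineMap.comp (AffineMap.id ℝ V - AffineMap.const ℝ V (b j))
  have hf : inner ℝ n w = f.linear w := by simp [f]
  rw [hf, affineMap_linear_eq_sum_coord_linear_smul b,
    Finset.sum_eq_single_of_mem i (Finset.mem_univ i), smul_eq_mul, mul_comm]
  · rfl
  · intro l _ hl
    have hfl : f (b l) = 0 := horth l hl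
    rw [hfl, smul_zero]

/-- `n` is the unit normal of the facet of the simplex `s` opposite to the vertex `x`, pointing out
of the simplex. -/
structure IsOutwardUnitNormal (s : Finset V) (x n : V) : Prop where
  norm_eq_one : ‖n‖ = 1
  orthogonal : ∀ y ∈ s, y ≠ x → ∀ z ∈ s, z ≠ x → inner ℝ n (y - z) = 0
  inner_neg : ∀ y ∈ s, y ≠ x → inner ℝ n (x - y) < 0

variable [FiniteDimensional ℝ V] [MeasurableSpace V] [BorelSpace V] [DecidableEq V] {m : ℕ}
  {s : Finset V}

lemma inner_setIntegral_facet (hV : finrank ℝ V = m + 1)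
    (hs : AffineIndependent ℝ ((↑) : s → V)) (hcard : s.card = finrank ℝ V + 1)
    (u : V →ᵃ[ℝ] V) (x : s) {n : V} (hn : IsOutwardUnitNormal s x n) :
    inner ℝ (∫ y in convexHull ℝ (s.erase x : Set V), u y ∂μHE[m]) n
      = -volume.real (convexHull ℝ (s : Set V))
        * ((simplexBasis hs hcard).coord x).linear (∑ y ∈ s.erase x, u y) := by
  have hcard_erase : (s.erase x).card = m + 1 := by
    rw [Finset.card_erase_of_mem x.2, hcard, hV, Nat.add_sub_cancel]
  obtain ⟨z, hz⟩ : (s.erase (x : V)).Nonempty := Finset.card_pos.1 (by omega)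
  obtain ⟨hzx, hzs⟩ := Finset.mem_erase.1 hz
  set height : ℝ := -inner ℝ n (x - z) with hheight
  have hpos : 0 < height := neg_pos.2 (hn.inner_neg z hzs hzx)
  have hnorm : ‖height • n‖ = height := by
    rw [norm_smul, hn.norm_eq_one, mul_one, Real.norm_of_nonneg hpos.le]
  have hne : height • n ≠ 0 := norm_ne_zero_iff.1 (hnorm.symm ▸ hpos.ne')
  have haltitude : ∀ y ∈ (s.erase x : Set V), inner ℝ (height • n) (y - x) = ‖height • n‖ ^ 2 := by
    intro y hy
    obtain ⟨hys, hyx⟩ : y ∈ s ∧ y ≠ x := by simpa using hy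
    have horth := hn.orthogonal y hys hyx z hzs hzx
    rw [hnorm, real_inner_smul_left, sq, hheight, ← inner_neg_right, neg_sub,
      ← sub_add_sub_cancel y z, inner_add_right, horth, zero_add]
  have hvol := volume_cone hV ⟨z, hz⟩ (s.erase x).finite_toSet hne haltitude
  rw [← Finset.coe_insert, Finset.insert_erase x.2, hnorm] at hvol
  have hlin := inner_eq_mul_coord_linear (simplexBasis hs hcard) (n := n) (i := x) (j := ⟨z, hzs⟩)
    (fun y hy => hn.orthogonal y y.2 (fun h => hy (Subtype.ext h)) z hzs hzx)
  rw [setIntegral_convexHull_finset_affineMap (hs.mono (Finset.erase_subset _ _)) hcard_erase,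
    real_inner_smul_left, real_inner_comm, hlin, hvol, simplexBasis_apply, simplexBasis_apply,
    ← neg_neg (inner ℝ n _), ← hheight]
  ring

lemma sum_inner_setIntegral_facet (hV : finrank ℝ V = m + 1)
    (hs : AffineIndependent ℝ ((↑) : s → V)) (hcard : s.card = finrank ℝ V + 1)
    (u : V →ᵃ[ℝ] V) {n : V → V} (hn : ∀ x ∈ s, IsOutwardUnitNormal s x (n x)) :
    ∑ x ∈ s, inner ℝ (∫ y in convexHull ℝ (s.erase x : Set V), u y ∂μHE[m]) (n x)
      = volume.real (convexHull ℝ (s : Set V)) * LinearMap.trace ℝ V u.linear := by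
  set b := simplexBasis hs hcard
  have hfacet : ∀ x : s,
      inner ℝ (∫ y in convexHull ℝ (s.erase (x : V) : Set V), u y ∂μHE[m]) (n x)
        = volume.real (convexHull ℝ (s : Set V)) *
          ((b.coord x).linear (u x) - (b.coord x).linear (∑ y ∈ s, u y)) := by
    intro x
    rw [inner_setIntegral_facet hV hs hcard u x (hn x x.2), ← Finset.add_sum_erase s u x.2, map_add]
    ring
  rw [← Finset.sum_coe_sort, Finset.sum_congr rfl fun x _ => hfacet x, ← Finset.mul_sum,
    Finset.sum_sub_distrib, sum_coord_linear_eq_zero, sub_zero, trace_linear_eq_sum_coord_linear b]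
  rfl

end Divergence

lemma divg_eq_trace {d : ℕ} (u : Pt d →ᵃ[ℝ] Pt d) : divg u = LinearMap.trace ℝ (Pt d) u.linear := by
  rw [LinearMap.trace_eq_matrix_trace ℝ (EuclideanSpace.basisFun (Fin d) ℝ).toBasis]
  simp [divg, partialDeriv, Matrix.trace, LinearMap.toMatrix_apply]

lemma exists_mem_Ioo_lineMap_mem_convexHull {ι V : Type*} [AddCommGroup V] [Module ℝ V] [Finite ι]
    (b : AffineBasis ι ℝ V) {i : ι} {c p : V} (hci : b.coord i c = 0)
    (hc : ∀ j ≠ i, 0 < b.coord j c) (hp : 0 < b.coord i p) :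
    ∃ t ∈ Set.Ioo (0 : ℝ) 1, AffineMap.lineMap c p t ∈ convexHull ℝ (Set.range b) := by
  have hnonneg : ∀ᶠ t in nhdsWithin (0 : ℝ) (Set.Ioi 0), ∀ j,
      0 ≤ b.coord j (AffineMap.lineMap c p t) := by
    rw [Filter.eventually_all]
    intro j
    simp only [AffineMap.apply_lineMap]
    rcases eq_or_ne j i with rfl | hj
    · filter_upwards [self_mem_nhdsWithin] with t ht
      rw [hci, AffineMap.lineMap_apply_ring', sub_zero, add_zero]
      exact mul_nonneg (le_of_lt ht) hp.le
    · have hlim : Filter.Tendsto (AffineMap.lineMap (b.coord j c) (b.coord j p))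
          (nhds (0 : ℝ)) (nhds (b.coord j c)) :=
        AffineMap.lineMap_continuous.tendsto' _ _ (AffineMap.lineMap_apply_zero _ _)
      filter_upwards [nhdsWithin_le_nhds (hlim.eventually_const_lt (hc j hj))] with t ht
        using ht.le
  obtain ⟨t, ht, htj⟩ := (Filter.Eventually.and (Ioo_mem_nhdsGT one_pos) hnonneg).exists
  exact ⟨t, ht, by rwa [b.convexHull_eq_nonneg_coord]⟩

lemma exists_mem_convexHull_coord_pos {ι V : Type*} [AddCommGroup V] [Module ℝ V] [Finite ι]
    [Nontrivial ι] (b : AffineBasis ι ℝ V) {i : ι} {p : V} (hp : 0 < b.coord i p) :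
    ∃ z ∈ convexHull ℝ (Set.range b), z ∈ convexHull ℝ (insert p (b '' {i}ᶜ)) ∧
      0 < b.coord i z := by
  classical
  have := Fintype.ofFinite ι
  set facet : Finset ι := {i}ᶜ
  have hcard : (0 : ℝ) < facet.card := by
    obtain ⟨j, hj⟩ := exists_ne i
    exact_mod_cast Finset.card_pos.2 ⟨j, by simpa [facet] using hj⟩
  have hweights := facet.sum_centroidWeights_eq_one_of_cast_card_ne_zero hcard.ne'
  set c := facet.affineCombination ℝ b (facet.centroidWeights ℝ)
  have hc : c ∈ convexHull ℝ (b '' {i}ᶜ) := by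
    have hmass := facet.centerMass_mem_convexHull (w := facet.centroidWeights ℝ) (z := b)
      (s := b '' {i}ᶜ) (fun j _ => by simp) (hweights ▸ one_pos)
      fun j hj => ⟨j, by simpa [facet] using hj, rfl⟩
    rwa [← affineCombination_eq_centerMass hweights] at hmass
  have hci : b.coord i c = 0 :=
    b.coord_apply_combination_of_notMem (by simp [facet]) hweights
  have hcj : ∀ j ≠ i, 0 < b.coord j c := fun j hj => by
    rw [b.coord_apply_combination_of_mem (by simpa [facet] using hj) hweights,
      Finset.centroidWeights_apply]
    exact inv_pos.2 hcard
  obtain ⟨t, ht, hz⟩ := exists_mem_Ioo_lineMap_mem_convexHull b hci hcj hp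
  refine ⟨_, hz, ?_, ?_⟩
  · exact (convex_convexHull ℝ _).lineMap_mem (convexHull_mono (Set.subset_insert _ _) hc)
      (subset_convexHull ℝ _ (Set.mem_insert _ _)) ⟨ht.1.le, ht.2.le⟩
  · rw [AffineMap.apply_lineMap, hci, AffineMap.lineMap_apply_ring', sub_zero, add_zero]
    exact mul_pos ht.1 hp

namespace Triangulation

variable {d : ℕ} {Ω : Set (Pt d)} {T : Triangulation d Ω}

lemma card_cell (K : T.Cell) : K.1.card = finrank ℝ (Pt d) + 1 := by
  rw [finrank_euclideanSpace_fin, T.card_eq K.1 K.2]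

/-- The barycentric coordinate system of an element. -/
noncomputable def cellBasis (K : T.Cell) : AffineBasis K.1 ℝ (Pt d) :=
  simplexBasis (T.indep K.1 K.2) (card_cell K)

lemma range_cellBasis (K : T.Cell) : Set.range (cellBasis K) = K.1 :=
  range_simplexBasis _ _

open Classical in
lemma mem_faces_iff {σ : Finset (Pt d)} : σ ∈ T.faces ↔ ∃ K ∈ T.cells, σ ⊆ K ∧ σ.card = d := by
  simp only [faces, Finset.mem_biUnion, Finset.mem_powersetCard]

lemma card_face (σ : T.Face) : σ.1.card = d := by
  obtain ⟨K, -, -, h⟩ := mem_faces_iff.1 σ.2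
  exact h

lemma face_nonempty (hd : 0 < d) (σ : T.Face) : σ.1.Nonempty :=
  Finset.card_pos.1 (by rwa [card_face])

open Classical in
/-- The unit normal of the face `σ` of the element `K` that points out of `K`: `n_σ` or `-n_σ`. -/
noncomputable def outwardNormal (O : T.Orientation) (K : T.Cell) (σ : T.Face) : Pt d :=
  if K = O.inn σ then O.normal σ else -O.normal σ

section Adjacency

variable [DecidableEq (Pt d)]

lemma exists_opposite_vertex {σ : T.Face} {K : T.Cell} (h : σ.1 ⊆ K.1) :
    ∃ x ∉ σ.1, insert x σ.1 = K.1 :=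
  Finset.exists_eq_insert_iff.2 ⟨h, by rw [card_face, T.card_eq K.1 K.2]⟩

lemma coord_cellBasis_of_mem_face {σ : T.Face} {K : T.Cell} {x : K.1} (hxσ : x.1 ∉ σ.1)
    (hK : insert x.1 σ.1 = K.1) {y : Pt d} (hy : y ∈ σ.1) : (cellBasis K).coord x y = 0 :=
  (cellBasis K).coord_apply_ne (j := ⟨y, hK ▸ Finset.mem_insert_of_mem hy⟩)
    fun h => hxσ (h ▸ hy)

lemma cell_eq_of_coord_pos (hd : 0 < d) {σ : T.Face} {K L : T.Cell} {x : K.1} (hxσ : x.1 ∉ σ.1)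
    (hK : insert x.1 σ.1 = K.1) {x' : Pt d} (hL : insert x' σ.1 = L.1)
    (hpos : 0 < (cellBasis K).coord x x') : K = L := by
  have : Nontrivial K.1 :=
    (Finset.one_lt_card_iff_nontrivial.1 (by rw [T.card_eq K.1 K.2]; omega)).coe_sort
  obtain ⟨z, hzK, hzL, hz⟩ := exists_mem_convexHull_coord_pos (cellBasis K) hpos
  have hfacet : cellBasis K '' {x}ᶜ ⊆ L.1 := by
    rintro _ ⟨y, hyx, rfl⟩
    have hy : y.1 ∈ insert x.1 σ.1 := by rw [hK]; exact y.2
    rw [← hL]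
    exact Finset.mem_insert_of_mem
      ((Finset.mem_insert.1 hy).resolve_left fun h => hyx (Subtype.ext h))
  have hzKL := T.conforming K.1 K.2 L.1 L.2 ⟨range_cellBasis K ▸ hzK,
    convexHull_mono (Set.insert_subset (hL ▸ Finset.mem_insert_self _ _) hfacet) hzL⟩
  have hxL : x.1 ∈ L.1 := by
    by_contra hxL
    refine hz.ne' (affineMap_eq_of_mem_convexHull (f := (cellBasis K).coord x) ?_ hzKL)
    rintro y ⟨hyK, hyL⟩
    refine coord_cellBasis_of_mem_face hxσ hK ?_
    rw [← hK] at hyK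
    exact (Finset.mem_insert.1 hyK).resolve_left fun h => hxL (h ▸ hyL)
  have hσL : σ.1 ⊆ L.1 := hL ▸ Finset.subset_insert _ _
  refine Subtype.ext (Finset.eq_of_subset_of_card_le (hK ▸ Finset.insert_subset hxL hσL) ?_)
  rw [T.card_eq K.1 K.2, T.card_eq L.1 L.2]

lemma inner_normal_sub_eq_mul_coord (O : T.Orientation) {σ : T.Face} {K : T.Cell} {x : K.1}
    (hxσ : x.1 ∉ σ.1) (hK : insert x.1 σ.1 = K.1) {y : Pt d} (hy : y ∈ σ.1) (p : Pt d) :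
    inner ℝ (O.normal σ) (p - y)
      = inner ℝ (O.normal σ) (x.1 - y) * (cellBasis K).coord x p := by
  have hyK : y ∈ K.1 := hK ▸ Finset.mem_insert_of_mem hy
  have hlin := inner_eq_mul_coord_linear (cellBasis K) (n := O.normal σ) (i := x) (j := ⟨y, hyK⟩)
    (fun z hz => O.normal_orthogonal σ z ((Finset.mem_insert.1 (hK.symm ▸ z.2)).resolve_left
      fun h => hz (Subtype.ext h)) y hy) (p - y)
  have hcoord := ((cellBasis K).coord x).linearMap_vsub p y
  rw [vsub_eq_sub, vsub_eq_sub, coord_cellBasis_of_mem_face hxσ hK hy, sub_zero] at hcoord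
  rwa [hcoord] at hlin

lemma inner_normal_sub_ne_zero (O : T.Orientation) {σ : T.Face} {K : T.Cell} {x : Pt d}
    (hxσ : x ∉ σ.1) (hK : insert x σ.1 = K.1) {y : Pt d} (hy : y ∈ σ.1) :
    inner ℝ (O.normal σ) (x - y) ≠ 0 := by
  intro h
  have hself := inner_normal_sub_eq_mul_coord O (x := ⟨x, hK ▸ Finset.mem_insert_self _ _⟩) hxσ hK
    hy (y + O.normal σ)
  rw [add_sub_cancel_left, h, zero_mul, real_inner_self_eq_norm_sq, O.norm_normal] at hself
  norm_num at hself

lemma cell_eq_of_same_side (hd : 0 < d) (O : T.Orientation) {σ : T.Face} {K L : T.Cell}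
    {x x' y : Pt d} (hxσ : x ∉ σ.1) (hK : insert x σ.1 = K.1) (hL : insert x' σ.1 = L.1)
    (hy : y ∈ σ.1)
    (hside : 0 < inner ℝ (O.normal σ) (x - y) * inner ℝ (O.normal σ) (x' - y)) : K = L := by
  have hx : x ∈ K.1 := hK ▸ Finset.mem_insert_self _ _
  rw [inner_normal_sub_eq_mul_coord O (x := ⟨x, hx⟩) hxσ hK hy x', ← mul_assoc] at hside
  exact cell_eq_of_coord_pos hd (x := ⟨x, hx⟩) hxσ hK hL
    (pos_of_mul_pos_right hside (mul_self_nonneg _))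

lemma inner_outwardNormal_neg (hd : 0 < d) (O : T.Orientation) {σ : T.Face} {K : T.Cell}
    {x y : Pt d} (hxσ : x ∉ σ.1) (hK : insert x σ.1 = K.1) (hy : y ∈ σ.1) :
    inner ℝ (outwardNormal O K σ) (x - y) < 0 := by
  unfold outwardNormal
  split_ifs with h
  · exact O.inner_inn σ y hy x (by rw [← h, ← hK]; exact Finset.mem_insert_self _ _) hxσ
  · rw [inner_neg_left, neg_lt_zero]
    refine lt_of_le_of_ne (not_lt.1 fun hneg => h ?_) (inner_normal_sub_ne_zero O hxσ hK hy).symm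
    obtain ⟨x', hx'σ, hinn⟩ := exists_opposite_vertex (O.subset_inn σ)
    have hneg' := O.inner_inn σ y hy x' (hinn ▸ Finset.mem_insert_self _ _) hx'σ
    exact cell_eq_of_same_side hd O hxσ hK hinn hy (mul_pos_of_neg_of_neg hneg hneg')

lemma isOutwardUnitNormal_outwardNormal (hd : 0 < d) (O : T.Orientation) {σ : T.Face} {K : T.Cell}
    {x : Pt d} (hxσ : x ∉ σ.1) (hK : insert x σ.1 = K.1) :
    IsOutwardUnitNormal K.1 x (outwardNormal O K σ) := by
  have hface : ∀ y ∈ K.1, y ≠ x → y ∈ σ.1 := fun y hy hyx =>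
    (Finset.mem_insert.1 (hK ▸ hy)).resolve_left hyx
  refine ⟨?_, fun y hy hyx z hz hzx => ?_, fun y hy hyx =>
    inner_outwardNormal_neg hd O hxσ hK (hface y hy hyx)⟩
  · unfold outwardNormal
    split_ifs <;> simp [O.norm_normal]
  · have horth := O.normal_orthogonal σ y (hface y hy hyx) z (hface z hz hzx)
    unfold outwardNormal
    split_ifs <;> simp [horth]

end Adjacency

lemma inn_ne_out (hd : 0 < d) (O : T.Orientation) {σ : T.Face} (hσ : σ ∈ T.intFaces) :
    O.inn σ ≠ O.out σ := by
  classical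
  intro h
  obtain ⟨y, hy⟩ := face_nonempty hd σ
  obtain ⟨x, hxσ, hinn⟩ := exists_opposite_vertex (O.subset_inn σ)
  have hx : x ∈ (O.inn σ).1 := hinn ▸ Finset.mem_insert_self _ _
  exact lt_asymm (O.inner_inn σ y hy x hx hxσ) (O.inner_out σ hσ y hy x (h ▸ hx) hxσ)

lemma subset_iff_eq_inn_or_eq_out (hd : 0 < d) (O : T.Orientation) {σ : T.Face}
    (hσ : σ ∈ T.intFaces) {K : T.Cell} : σ.1 ⊆ K.1 ↔ K = O.inn σ ∨ K = O.out σ := by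
  classical
  refine ⟨fun hσK => or_iff_not_imp_left.2 fun hinn => ?_, ?_⟩
  · obtain ⟨y, hy⟩ := face_nonempty hd σ
    obtain ⟨x, hxσ, hK⟩ := exists_opposite_vertex hσK
    obtain ⟨x', hx'σ, hout⟩ := exists_opposite_vertex (O.subset_out σ hσ)
    have hneg := inner_outwardNormal_neg hd O hxσ hK hy
    rw [outwardNormal, if_neg hinn, inner_neg_left, neg_lt_zero] at hneg
    exact cell_eq_of_same_side hd O hxσ hK hout hy
      (mul_pos hneg (O.inner_out σ hσ y hy x' (hout ▸ Finset.mem_insert_self _ _) hx'σ))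
  · rintro (rfl | rfl)
    exacts [O.subset_inn σ, O.subset_out σ hσ]

lemma card_face_eq_succ (hd : 0 < d) (σ : T.Face) : σ.1.card = d - 1 + 1 := by
  rw [card_face]; omega

lemma affineIndependent_face (σ : T.Face) : AffineIndependent ℝ ((↑) : σ.1 → Pt d) := by
  obtain ⟨K, hK, hσK, -⟩ := mem_faces_iff.1 σ.2
  exact (T.indep K hK).mono hσK

lemma faceIntegral_sub (hd : 0 < d) {V : Type*} [NormedAddCommGroup V] [NormedSpace ℝ V]
    (σ : T.Face) {f g : Pt d → V} (hf : Continuous f) (hg : Continuous g) :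
    T.faceIntegral σ (fun x => f x - g x) = T.faceIntegral σ f - T.faceIntegral σ g :=
  integral_sub
    (integrableOn_convexHull_finset_of_continuous (affineIndependent_face σ)
      (card_face_eq_succ hd σ) hf)
    (integrableOn_convexHull_finset_of_continuous (affineIndependent_face σ)
      (card_face_eq_succ hd σ) hg)

lemma faceIntegral_const (σ : T.Face) (c : ℝ) :
    T.faceIntegral σ (fun _ => c) = T.faceArea σ * c := by
  simp [faceIntegral, faceArea, measureReal_def]

lemma faceArea_mul_faceVel (hd : 0 < d) (O : T.Orientation) (u : T.PwAffine) (σ : T.Face) :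
    T.faceArea σ * T.faceVel O u σ
      = inner ℝ (T.faceIntegral σ (u (O.inn σ))) (O.normal σ) := by
  rcases eq_or_ne (T.faceArea σ) 0 with h0 | h0
  · have hzero : T.faceIntegral σ (u (O.inn σ)) = 0 :=
      setIntegral_measure_zero _ ((measureReal_eq_zero_iff
        (euclideanHausdorffMeasure_convexHull_lt_top (affineIndependent_face σ)
          (card_face_eq_succ hd σ)).ne).1 h0)
    rw [h0, hzero, zero_mul, inner_zero_left]
  · rw [faceVel, one_div, mul_inv_cancel_left₀ h0]

lemma faceIntegral_inn_eq_out (hd : 0 < d) {O : T.Orientation} {u : T.PwAffine}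
    (hu : u ∈ T.crouzeixRaviart O) {σ : T.Face} (hσ : σ ∈ T.intFaces) :
    T.faceIntegral σ (u (O.out σ)) = T.faceIntegral σ (u (O.inn σ)) := by
  have hmean := hu σ hσ
  rwa [faceIntegral_sub hd σ (AffineMap.continuous_of_finiteDimensional _)
    (AffineMap.continuous_of_finiteDimensional _), sub_eq_zero] at hmean

lemma notMem_intFaces {σ : T.Face} : σ ∉ T.intFaces ↔ σ ∈ T.extFaces := by
  simp only [intFaces, extFaces, Finset.mem_filter, Finset.mem_univ, true_and, not_not]

open Classical in
lemma sum_inner_faceIntegral_outwardNormal (hd : 0 < d) (O : T.Orientation) (K : T.Cell)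
    (v : Pt d →ᵃ[ℝ] Pt d) :
    ∑ σ : T.Face with σ.1 ⊆ K.1, inner ℝ (T.faceIntegral σ v) (outwardNormal O K σ)
      = volume.real (T.body K) * divg v := by
  have hface : ∀ x ∈ K.1, K.1.erase x ∈ T.faces := fun x hx =>
    mem_faces_iff.2 ⟨K.1, K.2, Finset.erase_subset _ _, by
      rw [Finset.card_erase_of_mem hx, T.card_eq K.1 K.2, Nat.add_sub_cancel]⟩
  let normal : Pt d → Pt d := fun x =>
    if hx : x ∈ K.1 then outwardNormal O K ⟨K.1.erase x, hface x hx⟩ else 0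
  have hnormal : ∀ x (hx : x ∈ K.1), normal x = outwardNormal O K ⟨K.1.erase x, hface x hx⟩ :=
    fun x hx => dif_pos hx
  have hV : finrank ℝ (Pt d) = d - 1 + 1 := by rw [finrank_euclideanSpace_fin]; omega
  rw [divg_eq_trace, body, ← sum_inner_setIntegral_facet hV (T.indep K.1 K.2) (card_cell K) v
    (n := normal) fun x hx => by
      rw [hnormal x hx]
      exact isOutwardUnitNormal_outwardNormal hd O (Finset.notMem_erase x K.1)
        (Finset.insert_erase hx)]
  refine (Finset.sum_bij (fun x hx => ⟨K.1.erase x, hface x hx⟩)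
    (fun x _ => by simp [Finset.erase_subset])
    (fun x hx y hy h => Finset.erase_injOn K.1 hx hy (congrArg Subtype.val h))
    (fun σ hσ => ?_) fun x hx => by rw [hnormal x hx]; rfl).symm
  obtain ⟨x, hxσ, hK⟩ := exists_opposite_vertex (Finset.mem_filter.1 hσ).2
  exact ⟨x, hK ▸ Finset.mem_insert_self _ _,
    Subtype.ext (by simp only [← hK, Finset.erase_insert hxσ])⟩

open Classical in
lemma sum_cells_inner_faceIntegral_outwardNormal (hd : 0 < d) {O : T.Orientation} {u : T.PwAffine}
    (hu : u ∈ T.crouzeixRaviart O) (p : T.PwConst) {σ : T.Face} (hσ : σ ∈ T.intFaces) :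
    ∑ K : T.Cell with σ.1 ⊆ K.1, p K * inner ℝ (T.faceIntegral σ (u K)) (outwardNormal O K σ)
      = -(T.faceArea σ * (T.faceVel O u σ * jump O p σ)) := by
  have hcells : (Finset.univ.filter fun K : T.Cell => σ.1 ⊆ K.1) = {O.inn σ, O.out σ} := by
    ext K
    simp [subset_iff_eq_inn_or_eq_out hd O hσ]
  rw [hcells, Finset.sum_pair (inn_ne_out hd O hσ), outwardNormal, outwardNormal, if_pos rfl,
    if_neg (inn_ne_out hd O hσ).symm, faceIntegral_inn_eq_out hd hu hσ, inner_neg_right,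
    ← faceArea_mul_faceVel hd, jump]
  ring

lemma sum_volume_mul_divg (hd : 0 < d) {O : T.Orientation} {u : T.PwAffine}
    (hu : u ∈ T.crouzeixRaviart₀ O) (p : T.PwConst) :
    ∑ K : T.Cell, volume.real (T.body K) * (p K * divg (u K))
      = -∑ σ ∈ T.intFaces, T.faceArea σ * (T.faceVel O u σ * jump O p σ) := by
  classical
  have hext : ∀ σ : T.Face, σ ∉ T.intFaces → ∑ K : T.Cell with σ.1 ⊆ K.1,
      p K * inner ℝ (T.faceIntegral σ (u K)) (outwardNormal O K σ) = 0 := by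
    refine fun σ hσ => Finset.sum_eq_zero fun K hK => ?_
    have hmean : T.faceIntegral σ (u K) = 0 :=
      hu.2 σ (notMem_intFaces.1 hσ) K (Finset.mem_filter.1 hK).2
    rw [hmean, inner_zero_left, mul_zero]
  calc ∑ K : T.Cell, volume.real (T.body K) * (p K * divg (u K))
      = ∑ K : T.Cell, ∑ σ : T.Face with σ.1 ⊆ K.1,
          p K * inner ℝ (T.faceIntegral σ (u K)) (outwardNormal O K σ) := by
        refine Finset.sum_congr rfl fun K _ => ?_
        rw [← Finset.mul_sum, sum_inner_faceIntegral_outwardNormal hd]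
        ring
    _ = ∑ σ : T.Face, ∑ K : T.Cell with σ.1 ⊆ K.1,
          p K * inner ℝ (T.faceIntegral σ (u K)) (outwardNormal O K σ) :=
        Finset.sum_comm' (by simp)
    _ = ∑ σ ∈ T.intFaces, ∑ K : T.Cell with σ.1 ⊆ K.1,
          p K * inner ℝ (T.faceIntegral σ (u K)) (outwardNormal O K σ) :=
        (Finset.sum_subset (Finset.subset_univ _) fun σ _ => hext σ).symm
    _ = _ := by
        rw [Finset.sum_congr rfl fun σ hσ =>
          sum_cells_inner_faceIntegral_outwardNormal hd hu.1 p hσ, Finset.sum_neg_distrib]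

end Triangulation

section MeanValue

variable {f : ℝ → ℝ} {x y : ℝ}

lemma exists_sub_eq_deriv_mul_sub (hf : ∀ z ∈ Set.uIcc x y, DifferentiableAt ℝ f z) :
    ∃ z ∈ Set.uIcc x y, f y - f x = deriv f z * (y - x) := by
  wlog hxy : x ≤ y generalizing x y
  · rw [Set.uIcc_comm] at hf ⊢
    obtain ⟨z, hz, h⟩ := this hf (le_of_not_ge hxy)
    exact ⟨z, hz, by linear_combination -h⟩
  rcases hxy.eq_or_lt with rfl | hlt
  · exact ⟨x, Set.left_mem_uIcc, by simp⟩
  rw [Set.uIcc_of_le hxy] at hf ⊢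
  obtain ⟨z, hz, h⟩ := exists_deriv_eq_slope f hlt
    (fun w hw => (hf w hw).continuousAt.continuousWithinAt)
    fun w hw => (hf w (Set.Ioo_subset_Icc_self hw)).differentiableWithinAt
  exact ⟨z, Set.Ioo_subset_Icc_self hz, by rw [h, div_mul_cancel₀ _ (sub_pos.2 hlt).ne']⟩

lemma iteratedDeriv_two : iteratedDeriv 2 f = deriv (deriv f) := by
  rw [iteratedDeriv_succ, iteratedDeriv_one]

lemma exists_taylor_two (hf : ∀ z ∈ Set.uIcc x y, ContDiffAt ℝ 2 f z) :
    ∃ z ∈ Set.uIcc x y,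
      f y = f x + deriv f x * (y - x) + iteratedDeriv 2 f z / 2 * (y - x) ^ 2 := by
  rcases eq_or_ne x y with rfl | hxy
  · exact ⟨x, Set.left_mem_uIcc, by simp⟩
  obtain ⟨z, hz, h⟩ := taylor_mean_remainder_lagrange_iteratedDeriv (n := 1) hxy
    fun w hw => (hf w hw).contDiffWithinAt
  have hderiv : derivWithin f (Set.uIcc x y) x = deriv f x :=
    ((hf x Set.left_mem_uIcc).differentiableAt two_ne_zero).derivWithin
      (uniqueDiffOn_uIcc hxy x Set.left_mem_uIcc)
  rw [taylorWithinEval_succ, taylor_within_zero_eval, iteratedDerivWithin_one, hderiv] at h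
  refine ⟨z, Set.Ioo_subset_Icc_self hz, ?_⟩
  simp only [Nat.factorial_zero, Nat.factorial_two, Nat.cast_zero, Nat.cast_one, Nat.cast_ofNat,
    zero_add, inv_one, one_mul, pow_one, smul_eq_mul, Nat.reduceAdd] at h
  linear_combination h

lemma exists_weighted_mean_eq {g : ℝ → ℝ} (hg : ContinuousOn g (Set.uIcc x y)) {z w : ℝ}
    (hz : z ∈ Set.uIcc x y) (hw : w ∈ Set.uIcc x y) {a b : ℝ} (ha : 0 ≤ a) (hb : 0 ≤ b) :
    ∃ q ∈ Set.uIcc x y, a * g z + b * g w = (a + b) * g q := by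
  have hconv : Convex ℝ (g '' Set.uIcc x y) :=
    (isPreconnected_uIcc.image g hg).ordConnected.convex
  rcases (add_nonneg ha hb).eq_or_lt' with h0 | hpos
  · exact ⟨z, hz, by rw [(add_eq_zero_iff_of_nonneg ha hb).1 h0 |>.1,
      (add_eq_zero_iff_of_nonneg ha hb).1 h0 |>.2]; ring⟩
  obtain ⟨q, hq, hgq⟩ := hconv (Set.mem_image_of_mem g hz) (Set.mem_image_of_mem g hw)
    (div_nonneg ha hpos.le) (div_nonneg hb hpos.le) (by rw [← add_div, div_self hpos.ne'])
  refine ⟨q, hq, ?_⟩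
  rw [hgq, smul_eq_mul, smul_eq_mul]
  field_simp

end MeanValue

section UpwindFlux

/-- The diffusive upwind flux `a [s]⁺ + b [s]⁻ - e (b - a)` through a face with normal velocity `s`
between the states `a` (upstream of the normal) and `b`, with artificial diffusion `e`. -/
noncomputable def upwindFlux {V : Type*} [AddCommGroup V] [Module ℝ V] (s e : ℝ) (a b : V) : V :=
  ((s + |s|) / 2) • a + ((s - |s|) / 2) • b - e • (b - a)

lemma inner_upwindFlux_smul_sub {V : Type*} [NormedAddCommGroup V] [InnerProductSpace ℝ V]
    (s e ra rb : ℝ) (a b : V) :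
    inner ℝ (upwindFlux s e (ra • a) (rb • b)) (b - a)
      = upwindFlux s e ra rb * (‖b‖ ^ 2 / 2 - ‖a‖ ^ 2 / 2)
        - ((if 0 ≤ s then ra else rb) * (|s| / 2) + e * ((rb + ra) / 2)) * ‖b - a‖ ^ 2 := by
  simp only [upwindFlux, norm_sub_sq_real, inner_sub_left, inner_add_left, inner_sub_right,
    real_inner_smul_left, real_inner_self_eq_norm_sq, real_inner_comm b a, smul_eq_mul]
  split_ifs with hs
  · rw [abs_of_nonneg hs]
    ring
  · rw [abs_of_neg (not_le.1 hs)]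
    ring

lemma upwindFlux_mul_indicator_sub_nonneg (s : ℝ) {e : ℝ} (he : 0 ≤ e) (a b : ℝ) :
    0 ≤ upwindFlux s e a b * ((if b ≤ 0 then 1 else 0) - if a ≤ 0 then 1 else 0) := by
  have hin : 0 ≤ (s + |s|) / 2 := by linarith [neg_abs_le s]
  have hout : (s - |s|) / 2 ≤ 0 := by linarith [le_abs_self s]
  simp only [upwindFlux, smul_eq_mul]
  by_cases ha : a ≤ 0 <;> by_cases hb : b ≤ 0
  · simp [ha, hb]
  · simp only [ha, hb, if_true, if_false]
    nlinarith [mul_nonpos_of_nonneg_of_nonpos hin ha,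
      mul_nonpos_of_nonpos_of_nonneg hout (not_le.1 hb).le,
      mul_nonneg he (show 0 ≤ b - a by linarith)]
  · simp only [ha, hb, if_true, if_false]
    nlinarith [mul_nonneg hin (not_le.1 ha).le, mul_nonneg_of_nonpos_of_nonpos hout hb,
      mul_nonneg he (show 0 ≤ a - b by linarith)]
  · simp [ha, hb]

variable {f : ℝ → ℝ} {a b : ℝ}

lemma exists_upwind_mul_deriv_sub_eq (hf : ∀ z ∈ Set.uIcc a b, ContDiffAt ℝ 2 f z) (s : ℝ) :
    ∃ z ∈ Set.uIcc a b, ((s + |s|) / 2 * a + (s - |s|) / 2 * b) * (deriv f b - deriv f a)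
      = s * ((b * deriv f b - f b) - (a * deriv f a - f a))
        - iteratedDeriv 2 f z * (b - a) ^ 2 * (|s| / 2) := by
  rcases le_or_gt 0 s with hs | hs
  · obtain ⟨z, hz, h⟩ := exists_taylor_two (Set.uIcc_comm a b ▸ hf)
    refine ⟨z, Set.uIcc_comm b a ▸ hz, ?_⟩
    rw [abs_of_nonneg hs]
    linear_combination -s * h
  · obtain ⟨z, hz, h⟩ := exists_taylor_two hf
    refine ⟨z, hz, ?_⟩
    rw [abs_of_neg hs]
    linear_combination s * h

lemma exists_upwindFlux_mul_deriv_sub_eq (hf : ∀ z ∈ Set.uIcc a b, ContDiffAt ℝ 2 f z) (s : ℝ)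
    {e : ℝ} (he : 0 ≤ e) :
    ∃ ζ ∈ Set.uIcc a b, upwindFlux s e a b * (deriv f b - deriv f a)
      = s * ((b * deriv f b - f b) - (a * deriv f a - f a))
        - iteratedDeriv 2 f ζ * (b - a) ^ 2 * (e + |s| / 2) := by
  have hderiv : ∀ z ∈ Set.uIcc a b, ContDiffAt ℝ 1 (deriv f) z := fun z hz =>
    (hf z hz).derivWithin (by norm_num)
  have hcont : ContinuousOn (iteratedDeriv 2 f) (Set.uIcc a b) := by
    rw [iteratedDeriv_two]
    exact fun z hz => ((hderiv z hz).derivWithin (m := 0) (by simp)).continuousAt.continuousWithinAt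
  obtain ⟨z, hz, hdiffusion⟩ := exists_sub_eq_deriv_mul_sub fun w hw =>
    (hderiv w hw).differentiableAt one_ne_zero
  rw [← iteratedDeriv_two] at hdiffusion
  obtain ⟨w, hw, hupwind⟩ := exists_upwind_mul_deriv_sub_eq hf s
  obtain ⟨ζ, hζ, hmean⟩ := exists_weighted_mean_eq hcont hz hw he
    (show 0 ≤ |s| / 2 by positivity)
  refine ⟨ζ, hζ, ?_⟩
  simp only [upwindFlux, smul_eq_mul]
  linear_combination hupwind - e * (b - a) * hdiffusion - (b - a) ^ 2 * hmean

end UpwindFlux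

lemma average_pos_of_ae_pos {X : Type*} [MeasurableSpace X] {μ : Measure X} [IsFiniteMeasure μ]
    (hμ : μ ≠ 0) {f : X → ℝ} (hf : Integrable f μ) (hpos : ∀ᵐ x ∂μ, 0 < f x) :
    0 < ⨍ x, f x ∂μ := by
  obtain ⟨x, hx, hle⟩ := exists_notMem_null_le_average hμ hf hpos
  exact (Classical.not_not.1 hx).trans_le hle

namespace Params

variable (P : Params)

lemma dt_div_two_nonneg : 0 ≤ P.dt / 2 :=
  (half_pos P.dt_pos).le

lemma nu_nonneg {d : ℕ} (hd : 2 ≤ d) : 0 ≤ P.nu d := by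
  have hd' : (2 : ℝ) ≤ d := by exact_mod_cast hd
  exact add_nonneg (mul_nonneg (div_nonneg (by linarith) (by linarith)) P.mu_pos.le) P.lam_nonneg

section BackwardDifference

lemma le_of_Dt_nonpos {a b : ℝ} (h : P.Dt a b ≤ 0) : b ≤ a :=
  sub_nonpos.1 (nonpos_of_mul_nonpos_right h (inv_pos.2 P.dt_pos))

lemma Dt_add {V : Type*} [AddCommGroup V] [Module ℝ V] (a' a b' b : V) :
    P.Dt (a' + b') (a + b) = P.Dt a' a + P.Dt b' b := by
  rw [Dt, Dt, Dt, ← smul_add, add_sub_add_comm]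

@[fun_prop]
lemma continuous_Dt {X V : Type*} [TopologicalSpace X] [AddCommGroup V] [Module ℝ V]
    [TopologicalSpace V] [IsTopologicalAddGroup V] [ContinuousConstSMul ℝ V] {f g : X → V}
    (hf : Continuous f) (hg : Continuous g) : Continuous fun x => P.Dt (f x) (g x) :=
  (hg.sub hf).const_smul _

variable {V : Type*} [NormedAddCommGroup V] [InnerProductSpace ℝ V]

lemma inner_Dt_smul_self (r' r : ℝ) (a' a : V) :
    inner ℝ (P.Dt (r' • a') (r • a)) a
      = P.Dt r' r * (‖a‖ ^ 2 / 2) + P.Dt (1 / 2 * r' * ‖a'‖ ^ 2) (1 / 2 * r * ‖a‖ ^ 2)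
        + P.dt / 2 * (r' * ‖P.Dt a' a‖ ^ 2) := by
  have hdt := P.dt_pos.ne'
  have hnorm : ‖P.Dt a' a‖ ^ 2 = P.dt⁻¹ ^ 2 * ‖a - a'‖ ^ 2 := by
    rw [Dt, norm_smul, mul_pow, Real.norm_eq_abs, sq_abs]
  rw [hnorm, norm_sub_sq_real, real_inner_comm a' a]
  simp only [Dt, inner_sub_left, real_inner_smul_left, real_inner_self_eq_norm_sq, smul_eq_mul]
  field_simp
  ring

lemma inner_Dt_self (b' b : V) :
    inner ℝ (P.Dt b' b) b
      = P.Dt (1 / 2 * ‖b'‖ ^ 2) (1 / 2 * ‖b‖ ^ 2) + P.dt / 2 * ‖P.Dt b' b‖ ^ 2 := by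
  simpa [Dt] using P.inner_Dt_smul_self 1 1 b' b

lemma exists_Dt_mul_deriv_eq {f : ℝ → ℝ} {r' r : ℝ}
    (hf : ∀ z ∈ Set.uIcc r' r, ContDiffAt ℝ 2 f z) :
    ∃ ξ ∈ Set.uIcc r' r, P.Dt r' r * deriv f r
      = P.Dt (f r') (f r) + P.dt / 2 * (iteratedDeriv 2 f ξ * |P.Dt r' r| ^ 2) := by
  obtain ⟨ξ, hξ, htaylor⟩ := exists_taylor_two (Set.uIcc_comm r' r ▸ hf)
  refine ⟨ξ, Set.uIcc_comm r r' ▸ hξ, ?_⟩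
  have hdt := P.dt_pos.ne'
  rw [sq_abs, htaylor]
  simp only [Dt, smul_eq_mul]
  field_simp
  ring

end BackwardDifference

section Potential

variable {r : ℝ}

lemma contDiffAt_potential (hr : r ≠ 0) : ContDiffAt ℝ 2 P.potential r :=
  contDiffAt_const.mul (Real.contDiffAt_rpow_const_of_ne hr)

lemma mul_deriv_potential_sub_potential (hr : r ≠ 0) :
    r * deriv P.potential r - P.potential r = P.pressure r := by
  have hderiv : deriv P.potential r = P.a / (P.gamma - 1) * (P.gamma * r ^ (P.gamma - 1)) :=
    ((Real.hasDerivAt_rpow_const (Or.inl hr)).const_mul _).deriv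
  have hgamma := (sub_pos.2 P.one_lt_gamma).ne'
  rw [hderiv, Real.rpow_sub_one hr, potential, pressure]
  field_simp

lemma potential''_nonneg (hr : 0 ≤ r) : 0 ≤ P.potential'' r := by
  have hgamma := P.one_lt_gamma
  have hderiv : P.potential'' r
      = P.a / (P.gamma - 1) * (P.gamma * (P.gamma - 1) * r ^ (P.gamma - 2)) := by
    have hpoch : (descPochhammer ℝ 2).eval P.gamma = P.gamma * (P.gamma - 1) := by
      simp [descPochhammer_succ_eval]
    change iteratedDeriv 2 (fun s => P.a / (P.gamma - 1) * s ^ P.gamma) r = _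
    rw [iteratedDeriv_const_mul_field, iteratedDeriv_eq_iterate, Real.iter_deriv_rpow_const,
      hpoch, Nat.cast_ofNat]
  rw [hderiv]
  have := P.a_pos
  have := sub_pos.2 hgamma
  have : 0 < P.gamma := by linarith
  positivity

end Potential

end Params

namespace Triangulation

variable {d : ℕ} {Ω : Set (Pt d)} {T : Triangulation d Ω}

section Integral

lemma isCompact_body (K : T.Cell) : IsCompact (T.body K) :=
  K.1.finite_toSet.isCompact_convexHull ℝ

lemma interior_body_nonempty (K : T.Cell) : (interior (T.body K)).Nonempty := by
  rw [body, ← range_cellBasis K]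
  exact ⟨_, (cellBasis K).centroid_mem_interior_convexHull⟩

lemma volume_body_pos (K : T.Cell) : 0 < volume (T.body K) :=
  Measure.measure_pos_of_nonempty_interior _ (interior_body_nonempty K)

lemma volume_body_ne_top (K : T.Cell) : volume (T.body K) ≠ ⊤ :=
  (isCompact_body K).measure_lt_top.ne

lemma volume_real_body_pos (K : T.Cell) : 0 < volume.real (T.body K) :=
  ENNReal.toReal_pos (volume_body_pos K).ne' (volume_body_ne_top K)

@[fun_prop]
lemma continuous_affineField (v : Pt d →ᵃ[ℝ] Pt d) : Continuous v :=
  v.continuous_of_finiteDimensional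

lemma integral_const (c : T.Cell → ℝ) :
    T.integral (fun K _ => c K) = ∑ K : T.Cell, volume.real (T.body K) * c K := by
  simp [integral, measureReal_def]

variable {f g : T.Cell → Pt d → ℝ}

lemma integral_nonneg (hf : ∀ K x, 0 ≤ f K x) : 0 ≤ T.integral f :=
  Finset.sum_nonneg fun K _ => MeasureTheory.integral_nonneg (hf K)

lemma integral_const_mul (c : ℝ) : T.integral (fun K x => c * f K x) = c * T.integral f := by
  simp only [integral, MeasureTheory.integral_const_mul, Finset.mul_sum]

lemma integral_add (hf : ∀ K, Continuous (f K)) (hg : ∀ K, Continuous (g K)) :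
    T.integral (fun K x => f K x + g K x) = T.integral f + T.integral g := by
  simp only [integral, ← Finset.sum_add_distrib]
  exact Finset.sum_congr rfl fun K _ => MeasureTheory.integral_add
    ((hf K).continuousOn.integrableOn_compact (isCompact_body K))
    ((hg K).continuousOn.integrableOn_compact (isCompact_body K))

lemma integral_sub (hf : ∀ K, Continuous (f K)) (hg : ∀ K, Continuous (g K)) :
    T.integral (fun K x => f K x - g K x) = T.integral f - T.integral g := by
  rw [eq_sub_iff_add_eq, ← integral_add (f := fun K x => f K x - g K x)
    (fun K => (hf K).sub (hg K)) hg]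
  simp only [sub_add_cancel]

lemma integral_Dt (P : Params) (hf : ∀ K, Continuous (f K)) (hg : ∀ K, Continuous (g K)) :
    T.integral (fun K x => P.Dt (f K x) (g K x)) = P.Dt (T.integral f) (T.integral g) := by
  simp only [Params.Dt, smul_eq_mul]
  rw [integral_const_mul, integral_sub hg hf]

lemma integral_inner_const (c : T.Cell → Pt d) (v : T.PwAffine) :
    T.integral (fun K x => inner ℝ (c K) (v K x))
      = T.integral fun K _ => inner ℝ (c K) (T.cellMean v K) := by
  rw [integral_const fun K => inner ℝ (c K) (T.cellMean v K)]
  refine Finset.sum_congr rfl fun K _ => ?_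
  have hint : IntegrableOn (v K) (T.body K) :=
    (continuous_affineField (v K)).continuousOn.integrableOn_compact (isCompact_body K)
  rw [integral_inner hint, cellMean, setAverage_eq, inner_smul_right, ← mul_assoc,
    mul_inv_cancel₀ (volume_real_body_pos K).ne', one_mul]

end Integral

variable {O : T.Orientation} {P : Params}

section Density

lemma restrict_body_le (T : Triangulation d Ω) (K : T.Cell) :
    volume.restrict (T.body K) ≤ volume.restrict Ω := by
  have hnull : volume (frontier (T.body K)) = 0 := (convex_convexHull ℝ _).addHaar_frontier volume
  rw [← Measure.restrict_congr_set (interior_ae_eq_of_null_frontier hnull)]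
  exact Measure.restrict_mono (T.interior_subset K.1 K.2) le_rfl

lemma setAverage_body_pos {ρ₀ : Pt d → ℝ} (hint : IntegrableOn ρ₀ Ω)
    (hpos : ∀ᵐ x ∂volume.restrict Ω, 0 < ρ₀ x) (K : T.Cell) : 0 < ⨍ x in T.body K, ρ₀ x := by
  have hfin : IsFiniteMeasure (volume.restrict (T.body K)) :=
    isFiniteMeasure_restrict.2 (volume_body_ne_top K)
  have hle := restrict_body_le T K
  exact average_pos_of_ae_pos (Measure.restrict_eq_zero.not.2 (volume_body_pos K).ne')
    (Integrable.mono_measure hint hle) (ae_mono hle hpos)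

lemma size_rpow_nonneg (T : Triangulation d Ω) (e : ℝ) : 0 ≤ T.size ^ e :=
  Real.rpow_nonneg (Real.iSup_nonneg fun _ => Metric.diam_nonneg) e

lemma faceArea_nonneg (σ : T.Face) : 0 ≤ T.faceArea σ := measureReal_nonneg

lemma flux_eq_upwindFlux {V : Type*} [AddCommGroup V] [Module ℝ V] (ε : ℝ) (r : T.Cell → V)
    (u : T.PwAffine) (σ : T.Face) :
    T.flux O ε r u σ = upwindFlux (T.faceVel O u σ) (T.size ^ ε) (r (O.inn σ)) (r (O.out σ)) :=
  rfl

variable {ρ' ρ : T.PwConst} {u : T.PwAffine}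

lemma ContinuityEq.integral_eq (hc : T.ContinuityEq O P ρ' ρ u) (φ : T.PwConst) :
    T.integral (fun K _ => P.Dt (ρ' K) (ρ K) * φ K)
      = ∑ σ ∈ T.intFaces, T.faceArea σ * (T.flux O P.eps ρ u σ * jump O φ σ) := by
  simpa only [faceIntegral_const, sub_eq_zero] using hc φ

lemma ContinuityEq.density_pos (hc : T.ContinuityEq O P ρ' ρ u) (hρ' : ∀ K, 0 < ρ' K)
    (K : T.Cell) : 0 < ρ K := by
  by_contra hK
  let φ : T.PwConst := fun L => if ρ L ≤ 0 then 1 else 0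
  have hflux : 0 ≤ T.integral fun L _ => P.Dt (ρ' L) (ρ L) * φ L := by
    rw [hc.integral_eq]
    exact Finset.sum_nonneg fun σ _ => mul_nonneg (faceArea_nonneg σ)
      (upwindFlux_mul_indicator_sub_nonneg _ (T.size_rpow_nonneg _) _ _)
  have hdecrease : ∀ L, ρ L ≤ 0 → P.Dt (ρ' L) (ρ L) < 0 := fun L hL =>
    mul_neg_of_pos_of_neg (inv_pos.2 P.dt_pos) (by linarith [hρ' L])
  refine hflux.not_gt ?_
  rw [integral_const fun L => P.Dt (ρ' L) (ρ L) * φ L]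
  refine Finset.sum_neg' (fun L _ => ?_) ⟨K, Finset.mem_univ K, ?_⟩
  · refine mul_nonpos_of_nonneg_of_nonpos (volume_real_body_pos L).le ?_
    by_cases hL : ρ L ≤ 0
    · simpa [φ, hL] using (hdecrease L hL).le
    · simp [φ, hL]
  · have hK := not_lt.1 hK
    exact mul_neg_of_pos_of_neg (volume_real_body_pos K) (by simpa [φ, hK] using hdecrease K hK)

lemma IsSolution.density_pos {N : ℕ} {ρ₀ : Pt d → ℝ} {ρ : ℕ → T.PwConst} {u B : ℕ → T.PwAffine}
    (hsol : T.IsSolution O P N ρ₀ ρ u B) (hint : IntegrableOn ρ₀ Ω)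
    (hpos : ∀ᵐ x ∂volume.restrict Ω, 0 < ρ₀ x) : ∀ k ≤ N, ∀ K, 0 < ρ k K
  | 0, _, K => hsol.init_density K ▸ setAverage_body_pos hint hpos K
  | k + 1, hk, K =>
    (hsol.continuity k hk).density_pos (hsol.density_pos hint hpos k (Nat.le_of_succ_le hk)) K

end Density

section Energy

/-- The kinetic energy `∫ ½ ρ |û|²`. -/
noncomputable def kineticEnergy (T : Triangulation d Ω) (ρ : T.PwConst) (u : T.PwAffine) : ℝ :=
  T.integral fun K _ => 1 / 2 * ρ K * ‖T.cellMean u K‖ ^ 2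

/-- The internal energy `∫ H(ρ)`. -/
noncomputable def internalEnergy (T : Triangulation d Ω) (P : Params) (ρ : T.PwConst) : ℝ :=
  T.integral fun K _ => P.potential (ρ K)

/-- The magnetic energy `∫ ½ |B|²`. -/
noncomputable def magneticEnergy (T : Triangulation d Ω) (B : T.PwAffine) : ℝ :=
  T.integral fun K x => 1 / 2 * ‖B K x‖ ^ 2

/-- The work `∫ p(ρ) div u` of the pressure, through which internal energy becomes kinetic. -/
noncomputable def pressureWork (T : Triangulation d Ω) (P : Params) (ρ : T.PwConst)
    (u : T.PwAffine) : ℝ :=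
  T.integral fun K _ => P.pressure (ρ K) * divg (u K)

/-- The work `∫ (Curl B × B') · u` of the Lorentz force, through which magnetic energy becomes
kinetic. -/
noncomputable def lorentzWork (T : Triangulation d Ω) (u B' B : T.PwAffine) : ℝ :=
  T.integral fun K x => crossProduct (curl (B K)) (toR3 (B' K x)) ⬝ᵥ toR3 (u K x)

lemma energy_eq (ρ : T.PwConst) (u B : T.PwAffine) :
    T.energy P ρ u B = T.kineticEnergy ρ u + T.internalEnergy P ρ + T.magneticEnergy B := by
  rw [energy, integral_add, integral_add]
  · rfl
  all_goals fun_prop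

variable {ρ' ρ : T.PwConst} {u' u B' B : T.PwAffine}

lemma integral_inner_Dt_eq :
    T.integral (fun K x =>
        inner ℝ (P.Dt (ρ' K • T.cellMean u' K) (ρ K • T.cellMean u K)) (u K x))
      = T.integral (fun K _ => P.Dt (ρ' K) (ρ K) * (‖T.cellMean u K‖ ^ 2 / 2))
        + P.Dt (T.kineticEnergy ρ' u') (T.kineticEnergy ρ u) + T.timeDissVelocity P ρ' u' u := by
  rw [integral_inner_const fun K => P.Dt (ρ' K • T.cellMean u' K) (ρ K • T.cellMean u K)]
  simp only [P.inner_Dt_smul_self]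
  rw [integral_add, integral_add, integral_Dt, integral_const_mul]
  · rfl
  all_goals fun_prop

lemma sum_inner_flux_jump_eq :
    ∑ σ ∈ T.intFaces, T.faceArea σ *
        inner ℝ (T.flux O P.eps (fun K => ρ K • T.cellMean u K) u σ) (jump O (T.cellMean u) σ)
      = ∑ σ ∈ T.intFaces, T.faceArea σ *
          (T.flux O P.eps ρ u σ * jump O (fun K => ‖T.cellMean u K‖ ^ 2 / 2) σ)
        - T.jumpDissVelocity O P ρ u := by
  simp only [jumpDissVelocity, faceIntegral_const, ← Finset.sum_sub_distrib, ← mul_sub]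
  refine Finset.sum_congr rfl fun σ _ => congrArg _ ?_
  exact inner_upwindFlux_smul_sub _ _ _ _ _ _

lemma kinetic_balance (hu : u ∈ T.crouzeixRaviart₀ O) (hc : T.ContinuityEq O P ρ' ρ u)
    (hm : T.MomentumEq O P ρ' ρ u' u B' B) :
    P.Dt (T.kineticEnergy ρ' u') (T.kineticEnergy ρ u)
        + P.mu * T.integral (fun K _ => gradInner (u K) (u K))
        + P.nu d * T.integral (fun K _ => divg (u K) ^ 2)
      = T.pressureWork P ρ u + T.lorentzWork u B' B
        - T.timeDissVelocity P ρ' u' u - T.jumpDissVelocity O P ρ u := by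
  have hstress : T.integral (fun K _ => (P.nu d * divg (u K) - P.pressure (ρ K)) * divg (u K))
      = P.nu d * T.integral (fun K _ => divg (u K) ^ 2) - T.pressureWork P ρ u := by
    simp only [sub_mul, mul_assoc, ← sq]
    rw [integral_sub, integral_const_mul, pressureWork]
    all_goals fun_prop
  have hmomentum := hm u hu
  have hcontinuity := hc.integral_eq fun K => ‖T.cellMean u K‖ ^ 2 / 2
  simp only [faceIntegral_const, integral_inner_Dt_eq, sum_inner_flux_jump_eq, hstress]
    at hmomentum
  rw [lorentzWork]
  linear_combination hmomentum - hcontinuity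

lemma internal_balance (hd : 0 < d) (hu : u ∈ T.crouzeixRaviart₀ O)
    (hc : T.ContinuityEq O P ρ' ρ u) (hρ' : ∀ K, 0 < ρ' K) (hρ : ∀ K, 0 < ρ K) :
    ∃ (ξ : T.PwConst) (ζ : T.Face → ℝ), (∀ K, ξ K ∈ Set.uIcc (ρ' K) (ρ K)) ∧
      (∀ σ, ζ σ ∈ Set.uIcc (ρ (O.inn σ)) (ρ (O.out σ))) ∧
      P.Dt (T.internalEnergy P ρ') (T.internalEnergy P ρ)
        = -T.pressureWork P ρ u - T.timeDissDensity P ξ ρ' ρ - T.jumpDissDensity O P ζ ρ u := by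
  have hsmooth : ∀ {a b : ℝ}, 0 < a → 0 < b → ∀ z ∈ Set.uIcc a b, ContDiffAt ℝ 2 P.potential z :=
    fun ha hb z hz => P.contDiffAt_potential ((lt_min ha hb).trans_le hz.1).ne'
  choose ξ hξ htime using fun K => P.exists_Dt_mul_deriv_eq (hsmooth (hρ' K) (hρ K))
  choose ζ hζ hjump using fun σ => exists_upwindFlux_mul_deriv_sub_eq
    (hsmooth (hρ (O.inn σ)) (hρ (O.out σ))) (T.faceVel O u σ) (T.size_rpow_nonneg P.eps)
  refine ⟨ξ, ζ, hξ, hζ, ?_⟩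
  have hcontinuity := hc.integral_eq fun K => deriv P.potential (ρ K)
  have hcells : T.integral (fun K _ => P.Dt (ρ' K) (ρ K) * deriv P.potential (ρ K))
      = P.Dt (T.internalEnergy P ρ') (T.internalEnergy P ρ) + T.timeDissDensity P ξ ρ' ρ := by
    simp only [htime]
    rw [integral_add, integral_Dt, integral_const_mul]
    · rfl
    all_goals fun_prop
  have hfaces : ∑ σ ∈ T.intFaces, T.faceArea σ *
        (T.flux O P.eps ρ u σ * jump O (fun K => deriv P.potential (ρ K)) σ)
      = -T.pressureWork P ρ u - T.jumpDissDensity O P ζ ρ u := by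
    rw [pressureWork, integral_const fun K => P.pressure (ρ K) * divg (u K),
      sum_volume_mul_divg hd hu fun K => P.pressure (ρ K)]
    simp only [jumpDissDensity, faceIntegral_const, neg_neg, ← Finset.sum_sub_distrib, ← mul_sub]
    refine Finset.sum_congr rfl fun σ _ => congrArg _ ?_
    simp only [jump, flux_eq_upwindFlux, hjump, Params.potential'',
      P.mul_deriv_potential_sub_potential (hρ _).ne']
  rw [hcells, hfaces] at hcontinuity
  linarith

@[fun_prop]
lemma continuous_toR3 : Continuous (toR3 (d := d)) := by
  refine continuous_pi fun i => ?_
  unfold toR3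
  split_ifs <;> fun_prop

lemma crossProduct_dotProduct_swap (a b c : Fin 3 → ℝ) :
    crossProduct a b ⬝ᵥ c = -(crossProduct c b ⬝ᵥ a) := by
  rw [dotProduct_comm, triple_product_permutation, ← cross_anticomm c b, dotProduct_neg,
    dotProduct_comm]

lemma magnetic_balance (hB : B ∈ T.nedelec₀ O) (hx : T.MaxwellEq O P u B' B) :
    P.Dt (T.magneticEnergy B') (T.magneticEnergy B)
        + P.alpha * T.integral (fun K _ => curl (B K) ⬝ᵥ curl (B K))
      = -T.lorentzWork u B' B - T.timeDissMagnetic P B' B := by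
  have hmaxwell := hx B hB
  simp only [P.inner_Dt_self, crossProduct_dotProduct_swap (toR3 (u _ _)), sub_neg_eq_add]
    at hmaxwell
  rw [integral_add, integral_add, integral_add, integral_Dt, integral_const_mul (P.dt / 2),
    integral_const_mul P.alpha] at hmaxwell
  · rw [magneticEnergy, magneticEnergy, timeDissMagnetic, lorentzWork]
    linear_combination hmaxwell
  all_goals fun_prop

end Energy

section Sign

variable {ρ' ρ ξ : T.PwConst} {u' u B' B : T.PwAffine}

lemma timeDissVelocity_nonneg (hρ' : ∀ K, 0 ≤ ρ' K) : 0 ≤ T.timeDissVelocity P ρ' u' u :=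
  mul_nonneg P.dt_div_two_nonneg (integral_nonneg fun K _ => mul_nonneg (hρ' K) (sq_nonneg _))

lemma timeDissMagnetic_nonneg : 0 ≤ T.timeDissMagnetic P B' B :=
  mul_nonneg P.dt_div_two_nonneg (integral_nonneg fun _ _ => sq_nonneg _)

lemma timeDissDensity_nonneg (hξ : ∀ K, 0 ≤ ξ K) : 0 ≤ T.timeDissDensity P ξ ρ' ρ :=
  mul_nonneg P.dt_div_two_nonneg
    (integral_nonneg fun K _ => mul_nonneg (P.potential''_nonneg (hξ K)) (sq_nonneg _))

lemma jumpDissVelocity_nonneg (hρ : ∀ K, 0 ≤ ρ K) : 0 ≤ T.jumpDissVelocity O P ρ u := by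
  simp only [jumpDissVelocity, faceIntegral_const]
  refine Finset.sum_nonneg fun σ _ => mul_nonneg (faceArea_nonneg σ) ?_
  have hupwind : 0 ≤ T.upwind O ρ u σ := ite_nonneg (hρ _) (hρ _)
  have havg : 0 ≤ avg O ρ σ := div_nonneg (add_nonneg (hρ _) (hρ _)) zero_le_two
  have hsize := T.size_rpow_nonneg P.eps
  positivity

lemma jumpDissDensity_nonneg {ζ : T.Face → ℝ} (hζ : ∀ σ, 0 ≤ ζ σ) :
    0 ≤ T.jumpDissDensity O P ζ ρ u := by
  simp only [jumpDissDensity, faceIntegral_const]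
  refine Finset.sum_nonneg fun σ _ => mul_nonneg (faceArea_nonneg σ) ?_
  have hpotential := P.potential''_nonneg (hζ σ)
  have hsize := T.size_rpow_nonneg P.eps
  positivity

lemma physicalDissipation_nonneg (hd : 2 ≤ d) : 0 ≤ T.physicalDissipation P u B := by
  refine add_nonneg (add_nonneg (mul_nonneg P.mu_pos.le (integral_nonneg fun K _ => ?_))
    (mul_nonneg (P.nu_nonneg hd) (integral_nonneg fun K _ => sq_nonneg _)))
    (mul_nonneg P.alpha_pos.le (integral_nonneg fun K _ => ?_))
  · exact Finset.sum_nonneg fun i _ => Finset.sum_nonneg fun j _ => mul_self_nonneg _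
  · exact Finset.sum_nonneg fun i _ => mul_self_nonneg _

end Sign

lemma exists_energy_balance {ρ' ρ : T.PwConst} {u' u B' B : T.PwAffine} (hd : 0 < d)
    (hρ' : ∀ K, 0 < ρ' K) (hρ : ∀ K, 0 < ρ K) (hu : u ∈ T.crouzeixRaviart₀ O)
    (hB : B ∈ T.nedelec₀ O) (hc : T.ContinuityEq O P ρ' ρ u)
    (hm : T.MomentumEq O P ρ' ρ u' u B' B) (hx : T.MaxwellEq O P u B' B) :
    ∃ (ξ : T.PwConst) (ζ : T.Face → ℝ), (∀ K, ξ K ∈ Set.uIcc (ρ' K) (ρ K)) ∧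
      (∀ σ, ζ σ ∈ Set.uIcc (ρ (O.inn σ)) (ρ (O.out σ))) ∧
      P.Dt (T.energy P ρ' u' B') (T.energy P ρ u B) + T.physicalDissipation P u B
        = -T.timeDissVelocity P ρ' u' u - T.timeDissMagnetic P B' B - T.timeDissDensity P ξ ρ' ρ
          - T.jumpDissVelocity O P ρ u - T.jumpDissDensity O P ζ ρ u := by
  obtain ⟨ξ, ζ, hξ, hζ, hinternal⟩ := internal_balance hd hu hc hρ' hρ
  refine ⟨ξ, ζ, hξ, hζ, ?_⟩
  rw [energy_eq, energy_eq, P.Dt_add, P.Dt_add, physicalDissipation]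
  linear_combination kinetic_balance hu hc hm + hinternal + magnetic_balance hB hx

end Triangulation

end MHD

/-- For `d ≥ 4` the cross products and curls only see the first three coordinates. -/
theorem mainTheorem4_general {d : ℕ} (hd : 2 ≤ d) {Ω : Set (MHD.Pt d)}
    {T : MHD.Triangulation d Ω} {O : T.Orientation} {P : MHD.Params}
    {ρ' ρ : T.PwConst} {u' u B' B : T.PwAffine} (hρ' : ∀ K, 0 < ρ' K)
    (hu : u ∈ T.crouzeixRaviart₀ O) (hB : B ∈ T.nedelec₀ O) (hc : T.ContinuityEq O P ρ' ρ u)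
    (hm : T.MomentumEq O P ρ' ρ u' u B' B) (hx : T.MaxwellEq O P u B' B) :
    ∃ (ξ : T.PwConst) (ζ : T.Face → ℝ),
      (∀ K, ξ K ∈ Set.uIcc (ρ' K) (ρ K)) ∧
      (∀ σ ∈ T.intFaces, ζ σ ∈ Set.uIcc (ρ (O.inn σ)) (ρ (O.out σ))) ∧
      P.Dt (T.energy P ρ' u' B') (T.energy P ρ u B) + T.physicalDissipation P u B
        = -T.timeDissVelocity P ρ' u' u - T.timeDissMagnetic P B' B - T.timeDissDensity P ξ ρ' ρ
          - T.jumpDissVelocity O P ρ u - T.jumpDissDensity O P ζ ρ u ∧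
      0 ≤ T.timeDissVelocity P ρ' u' u ∧
      0 ≤ T.timeDissMagnetic P B' B ∧
      0 ≤ T.timeDissDensity P ξ ρ' ρ ∧
      0 ≤ T.jumpDissVelocity O P ρ u ∧
      0 ≤ T.jumpDissDensity O P ζ ρ u ∧
      -T.timeDissVelocity P ρ' u' u - T.timeDissMagnetic P B' B - T.timeDissDensity P ξ ρ' ρ
          - T.jumpDissVelocity O P ρ u - T.jumpDissDensity O P ζ ρ u ≤ 0 ∧
      T.energy P ρ u B ≤ T.energy P ρ' u' B' := by
  have hρ := hc.density_pos hρ'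
  obtain ⟨ξ, ζ, hξ, hζ, hbalance⟩ :=
    MHD.Triangulation.exists_energy_balance (by omega) hρ' hρ hu hB hc hm hx
  have hξ_nonneg : ∀ K, 0 ≤ ξ K := fun K => (le_min (hρ' K).le (hρ K).le).trans (hξ K).1
  have hζ_nonneg : ∀ σ, 0 ≤ ζ σ := fun σ => (le_min (hρ _).le (hρ _).le).trans (hζ σ).1
  have hvel := T.timeDissVelocity_nonneg (P := P) (u' := u') (u := u) fun K => (hρ' K).le
  have hmag := T.timeDissMagnetic_nonneg (P := P) (B' := B') (B := B)
  have hden := T.timeDissDensity_nonneg (P := P) (ρ' := ρ') (ρ := ρ) hξ_nonneg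
  have hjumpVel := T.jumpDissVelocity_nonneg (O := O) (P := P) (u := u) fun K => (hρ K).le
  have hjumpDen := T.jumpDissDensity_nonneg (O := O) (P := P) (ρ := ρ) (u := u) hζ_nonneg
  have hphysical := T.physicalDissipation_nonneg (P := P) (u := u) (B := B) hd
  exact ⟨ξ, ζ, hξ, fun σ _ => hζ σ, hbalance, hvel, hmag, hden, hjumpVel, hjumpDen,
    by linarith, P.le_of_Dt_nonpos (by linarith)⟩

theorem mainTheorem4 (d : ℕ) (hd : d = 2 ∨ d = 3)
    (Ω : Set (MHD.Pt d)) (hΩ_open : IsOpen Ω) (hΩ_conn : IsConnected Ω)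
    (hΩ_bdd : Bornology.IsBounded Ω)
    (T : MHD.Triangulation d Ω) (O : T.Orientation) (P : MHD.Params) (N : ℕ)
    (ρ₀ : MHD.Pt d → ℝ) (hρ₀_int : IntegrableOn ρ₀ Ω volume)
    (hρ₀_pos : ∀ᵐ x ∂(volume.restrict Ω), 0 < ρ₀ x)
    (ρ : ℕ → T.PwConst) (u B : ℕ → T.PwAffine)
    (hsol : T.IsSolution O P N ρ₀ ρ u B) :
    ∀ k < N, ∃ (ξ : T.PwConst) (ζ : T.Face → ℝ),
      (∀ K : T.Cell, ξ K ∈ Set.uIcc (ρ k K) (ρ (k + 1) K)) ∧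
      (∀ σ ∈ T.intFaces, ζ σ ∈ Set.uIcc (ρ (k + 1) (O.inn σ)) (ρ (k + 1) (O.out σ))) ∧
      -- the discrete energy balance
      P.Dt (T.energy P (ρ k) (u k) (B k)) (T.energy P (ρ (k + 1)) (u (k + 1)) (B (k + 1)))
          + T.physicalDissipation P (u (k + 1)) (B (k + 1))
        = - T.timeDissVelocity P (ρ k) (u k) (u (k + 1))
          - T.timeDissMagnetic P (B k) (B (k + 1))
          - T.timeDissDensity P ξ (ρ k) (ρ (k + 1))
          - T.jumpDissVelocity O P (ρ (k + 1)) (u (k + 1))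
          - T.jumpDissDensity O P ζ (ρ (k + 1)) (u (k + 1)) ∧
      -- every term on its right-hand side is nonpositive
      0 ≤ T.timeDissVelocity P (ρ k) (u k) (u (k + 1)) ∧
      0 ≤ T.timeDissMagnetic P (B k) (B (k + 1)) ∧
      0 ≤ T.timeDissDensity P ξ (ρ k) (ρ (k + 1)) ∧
      0 ≤ T.jumpDissVelocity O P (ρ (k + 1)) (u (k + 1)) ∧
      0 ≤ T.jumpDissDensity O P ζ (ρ (k + 1)) (u (k + 1)) ∧
      -- and so is their sum, and the total energy does not increase
      - T.timeDissVelocity P (ρ k) (u k) (u (k + 1))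
          - T.timeDissMagnetic P (B k) (B (k + 1))
          - T.timeDissDensity P ξ (ρ k) (ρ (k + 1))
          - T.jumpDissVelocity O P (ρ (k + 1)) (u (k + 1))
          - T.jumpDissDensity O P ζ (ρ (k + 1)) (u (k + 1)) ≤ 0 ∧
      T.energy P (ρ (k + 1)) (u (k + 1)) (B (k + 1)) ≤ T.energy P (ρ k) (u k) (B k) := by
  intro k hk
  exact mainTheorem4_general (by omega) (hsol.density_pos hρ₀_int hρ₀_pos k hk.le)
    (hsol.velocity_mem k hk) (hsol.magnetic_mem k hk) (hsol.continuity k hk) (hsol.momentum k hk)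
    (hsol.maxwell k hk)
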